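/- Let $\mathbb{K}\in\{\mathbb{R},\mathbb{C}\}$ and $\mathbb{N}=\{1,2,\dots\}$. Lie groups are $C^\infty_{\mathbb K}$-Lie groups modelled on Hausdorff locally convex spaces, where $C^\infty$ is understood in the sense of Keller's $C^k_c$-calculus (all iterated directional derivatives exist and are jointly continuous); $L(G):=T_{\mathbf 1}G$. A locally convex space $E$ is Mackey complete if the Riemann integral $\int_0^1\gamma(t)\,dt$ exists in $E$ for each smooth curve $\gamma\colon\mathbb{R}\to E$. For $n\in\mathbb{N}_0\cup\{\infty\}$, the $C^n$-topology on $C^\infty([0,1],E)$ is the topology of uniform convergence of the derivatives of order $\le n$; unless stated otherwise, $C^\infty([0,1],E)$ carries the $C^\infty$-topology. A Lie group $G$ is regular (in Milnor's sense) if for each $\gamma\in C^\infty([0,1],L(G))$ there is a (necessarily unique) smooth curve $\eta_\gamma\colon[0,1]\to G$ with $\eta_\gamma(0)=\mathbf 1$ and $\eta_\gamma'(t)=\eta_\gamma(t)\cdot\gamma(t)$ for all $t\in[0,1]$, and the evolution map $\mathrm{evol}_G\colon C^\infty([0,1],L(G))\to G$, $\gamma\mapsto\eta_\gamma(1)$ is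 smooth. **Proposition.** For each $n\in\mathbb{N}$, let $H_n$ be a Lie group modelled on a Mackey complete locally convex space, such that $H_n$ is regular but $\mathrm{evol}_{H_n}\colon C^\infty([0,1],L(H_n))\to H_n$ is discontinuous with respect to the $C^n$-topology on $C^\infty([0,1],L(H_n))$. Let $$G:=\prod_{n\in\mathbb{N}}^{*}H_n=\Big\{(g_n)_{n}\in\prod_{n\in\mathbb{N}}H_n\colon g_n=\mathbf 1\text{ for all but finitely many }n\Big\}$$ be the weak direct product, with the box topology and its natural manifold structure, whose charts are the maps $(g_n)_n\mapsto(\phi_n(g_n))_n\in\bigoplus_n L(H_n)$ defined on boxes, for charts $\phi_n$ of $H_n$ such that $\phi_n(\mathbf 1)=0$ for all but finitely many $n$. Then: 1. $G$ is a Lie group modelled on the locally convex space $\bigoplus_{n\in\mathbb{N}}L(H_n)$ with the box topology, and $L(G)=\bigoplus_{n\in\mathbb{N}}L(H_n)$, i.e. the inclusions $H_n\to G$ induce on tangent spaces at $\mathbf 1$ the canonical inclusions $L(H_n)\to\bigoplus_{k}L(H_k)$. 2. $\bigoplus_{n\in\mathbb{N}}L(H_n)$ is Mackey complete. 3. For each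 $\gamma\in C^\infty([0,1],L(G))$ there exists a unique smooth curve $\eta_\gamma\colon[0,1]\to G$ with $\eta_\gamma(0)=\mathbf 1$ and $\eta_\gamma'(t)=\eta_\gamma(t)\cdot\gamma(t)$ for all $t\in[0,1]$; hence $\mathrm{evol}_G\colon C^\infty([0,1],L(G))\to G$, $\gamma\mapsto\eta_\gamma(1)$ is defined. 4. $\mathrm{evol}_G$ is not continuous, and thus $G$ is not a regular Lie group in Milnor's sense. -/

import Mathlib

open scoped Topology unitInterval DirectSum
open Filter Set

/-! Lie groups modelled on Hausdorff locally convex spaces over `𝕜 = ℝ` or `ℂ`, in the setting of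
Keller's `C^k_c`-calculus; regularity in Milnor's sense; weak direct products. -/

noncomputable section

namespace LCLie

/-! ### Differential calculus in topological vector spaces -/

section Calculus

variable (𝕜 : Type*) [RCLike 𝕜]
variable {E : Type*} [AddCommGroup E] [Module 𝕜 E] [TopologicalSpace E]
variable {F : Type*} [AddCommGroup F] [Module 𝕜 F] [TopologicalSpace F]

/-- The directional derivative `(D_y f)(x) = lim_{t → 0} (f (x + t y) - f x) / t` (with `t ∈ 𝕜`)
exists and equals `v`. -/
def HasDirDerivAt (f : E → F) (x y : E) (v : F) : Prop :=
  Tendsto (fun t : 𝕜 => t⁻¹ • (f (x + t • y) - f x)) (𝓝[≠] 0) (𝓝 v)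

/-- `f` is `C^∞` over `𝕜` on the open set `U`: the iterated directional derivatives
`d k x (y₀, …, y_{k-1}) = (D_{y_{k-1}} ⋯ D_{y₀} f)(x)` exist for all `x ∈ U`, and each
`d k : U × E^k → F` is continuous (in particular, so is `d 0 = f`). -/
def IsSmoothOn (f : E → F) (U : Set E) : Prop :=
  ∃ d : (k : ℕ) → E → (Fin k → E) → F,
    (∀ x ∈ U, ∀ y, d 0 x y = f x) ∧
    (∀ k, ∀ x ∈ U, ∀ y : Fin (k + 1) → E,
      HasDirDerivAt 𝕜 (fun z => d k z (Fin.init y)) x (y (Fin.last k)) (d (k + 1) x y)) ∧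
    ∀ k, ContinuousOn (fun p : E × (Fin k → E) => d k p.1 p.2) (U ×ˢ univ)

/-- The curve `γ`, defined on `T ⊆ ℝ`, has derivative `v` at `t` (one-sided at an end point of an
interval `T`). -/
def HasCurveDerivAt {T : Set ℝ} (γ : T → E) (v : E) (t : T) : Prop :=
  Tendsto (fun s : T => (((s : ℝ) - (t : ℝ) : ℝ) : 𝕜)⁻¹ • (γ s - γ t)) (𝓝[≠] t) (𝓝 v)

/-- The curve `γ`, defined on `T ⊆ ℝ`, is smooth on the relatively open subset `J` of `T`:
all iterated derivatives `D k = γ^{(k)}` exist on `J` and are continuous there. -/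
def IsSmoothCurveOn {T : Set ℝ} (γ : T → E) (J : Set T) : Prop :=
  ∃ D : ℕ → T → E, EqOn (D 0) γ J ∧
    ∀ k, ContinuousOn (D k) J ∧ ∀ t ∈ J, HasCurveDerivAt 𝕜 (D k) (D (k + 1) t) t

/-- `v` is the Riemann integral `∫₀¹ γ(t) dt`: the limit of the Riemann sums of `γ` over tagged
partitions `0 = t₀ ≤ ⋯ ≤ t_m = 1` as the mesh tends to `0`. -/
def HasRiemannIntegral (γ : ℝ → E) (v : E) : Prop :=
  ∀ W ∈ 𝓝 v, ∃ δ : ℝ, 0 < δ ∧ ∀ (m : ℕ) (t : Fin (m + 1) → ℝ) (ξ : Fin m → ℝ),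
    Monotone t → t 0 = 0 → t (Fin.last m) = 1 →
    (∀ i : Fin m, t i.castSucc ≤ ξ i ∧ ξ i ≤ t i.succ) →
    (∀ i : Fin m, t i.succ - t i.castSucc < δ) →
    ∑ i : Fin m, ((t i.succ - t i.castSucc : ℝ) : 𝕜) • γ (ξ i) ∈ W

variable (E) in
/-- Mackey completeness: every smooth curve `ℝ → E` has a Riemann integral over `[0,1]` in `E`. -/
def IsMackeyComplete : Prop :=
  ∀ γ : ℝ → E, IsSmoothCurveOn 𝕜 (fun t : (univ : Set ℝ) => γ t) univ →
    ∃ v, HasRiemannIntegral 𝕜 γ v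

end Calculus

/-! ### The space `C^∞([0,1], E)` and its topologies -/

section SmoothCurve

variable (𝕜 : Type*) [RCLike 𝕜]
variable (E : Type*) [AddCommGroup E] [Module 𝕜 E] [TopologicalSpace E]
  [IsTopologicalAddGroup E] [ContinuousSMul 𝕜 E]

/-- The vector space of smooth curves `[0,1] → E`, as a subspace of all functions. -/
def smoothCurveSubmodule : Submodule 𝕜 (I → E) where
  carrier := {γ | IsSmoothCurveOn 𝕜 γ univ}
  zero_mem' := ⟨fun _ _ => 0, fun _ _ => rfl, fun _ =>
    ⟨continuousOn_const, fun _ _ => by simp [HasCurveDerivAt, tendsto_const_nhds]⟩⟩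
  add_mem' := by
    rintro a b ⟨D, hD0, hD⟩ ⟨D', hD0', hD'⟩
    refine ⟨fun k t => D k t + D' k t, fun t ht => ?_, fun k => ⟨?_, fun t ht => ?_⟩⟩
    · simp [hD0 ht, hD0' ht]
    · exact (hD k).1.add (hD' k).1
    · have h := ((hD k).2 t ht).add ((hD' k).2 t ht)
      refine Tendsto.congr (fun s => ?_) h
      rw [← smul_add, ← add_sub_add_comm]
  smul_mem' := by
    rintro c a ⟨D, hD0, hD⟩
    refine ⟨fun k t => c • D k t, fun t ht => ?_, fun k => ⟨?_, fun t ht => ?_⟩⟩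
    · simp [hD0 ht]
    · exact (hD k).1.const_smul c
    · have h := ((hD k).2 t ht).const_smul c
      refine Tendsto.congr (fun s => ?_) h
      rw [← smul_sub, smul_comm]

/-- The space `C^∞([0,1], E)`. It is a type of its own, since its topology is not the topology of
pointwise convergence. -/
def SmoothCurve : Type _ := ↥(smoothCurveSubmodule 𝕜 E)

instance : AddCommGroup (SmoothCurve 𝕜 E) :=
  inferInstanceAs (AddCommGroup ↥(smoothCurveSubmodule 𝕜 E))

instance : Module 𝕜 (SmoothCurve 𝕜 E) :=
  inferInstanceAs (Module 𝕜 ↥(smoothCurveSubmodule 𝕜 E))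

instance : CoeFun (SmoothCurve 𝕜 E) (fun _ => I → E) := ⟨fun γ => γ.1⟩

variable {𝕜 E}

/-- The `k`-th derivative `γ^{(k)} : [0,1] → E` (unique, as soon as `E` is Hausdorff). -/
def SmoothCurve.iterDeriv (k : ℕ) (γ : SmoothCurve 𝕜 E) : C(I, E) where
  toFun := γ.2.choose k
  continuous_toFun := continuousOn_univ.1 (γ.2.choose_spec.2 k).1

variable (𝕜 E)

/-- The `C^n`-topology on `C^∞([0,1], E)`, for `n ∈ ℕ₀ ∪ {∞}`: the initial topology with respect to
the maps `γ ↦ γ^{(k)} ∈ C([0,1], E)`, `k ≤ n`, where `C([0,1], E)` carries the compact-open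
topology (i.e. the topology of uniform convergence). -/
@[reducible] def curveTopology (n : ℕ∞) : TopologicalSpace (SmoothCurve 𝕜 E) :=
  ⨅ k : ℕ, ⨅ _ : (k : ℕ∞) ≤ n,
    TopologicalSpace.induced (SmoothCurve.iterDeriv k) ContinuousMap.compactOpen

/-- The usual topology on `C^∞([0,1], E)` is the `C^∞`-topology. -/
instance : TopologicalSpace (SmoothCurve 𝕜 E) := curveTopology 𝕜 E ⊤

end SmoothCurve

/-! ### Lie groups and regularity -/

section LieGroup

variable (𝕜 : Type*) [RCLike 𝕜]
variable (E : Type*) [AddCommGroup E] [Module 𝕜 E] [TopologicalSpace E]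
variable (G : Type*) [TopologicalSpace G] [ChartedSpace E G]

/-- With the atlas given by its `ChartedSpace` structure, the group `G` is a `C^∞`-Lie group over
`𝕜` modelled on the Hausdorff locally convex space `E`. (`PolynormableSpace 𝕜 E` says that the
topology of `E` is the vector topology defined by a family of `𝕜`-seminorms.) -/
structure IsLieGroup [Group G] : Prop where
  model_t2 : T2Space E
  model_locallyConvex : PolynormableSpace 𝕜 E
  t2 : T2Space G
  smooth_transition : ∀ e ∈ atlas E G, ∀ e' ∈ atlas E G,
    IsSmoothOn 𝕜 (fun x => e' (e.symm x)) {x | x ∈ e.target ∧ e.symm x ∈ e'.source}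
  continuous_mul : Continuous fun p : G × G => p.1 * p.2
  continuous_inv : Continuous fun g : G => g⁻¹
  smooth_mul : ∀ e₁ ∈ atlas E G, ∀ e₂ ∈ atlas E G, ∀ e₃ ∈ atlas E G,
    IsSmoothOn 𝕜 (fun p : E × E => e₃ (e₁.symm p.1 * e₂.symm p.2))
      {p | p.1 ∈ e₁.target ∧ p.2 ∈ e₂.target ∧ e₁.symm p.1 * e₂.symm p.2 ∈ e₃.source}
  smooth_inv : ∀ e₁ ∈ atlas E G, ∀ e₂ ∈ atlas E G,
    IsSmoothOn 𝕜 (fun x => e₂ (e₁.symm x)⁻¹) {x | x ∈ e₁.target ∧ (e₁.symm x)⁻¹ ∈ e₂.source}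

variable {G}

/-- The map `f : F → G` from a topological vector space to a manifold is smooth. -/
def IsSmoothMap {F : Type*} [AddCommGroup F] [Module 𝕜 F] [TopologicalSpace F] (f : F → G) : Prop :=
  Continuous f ∧ ∀ e ∈ atlas E G, IsSmoothOn 𝕜 (fun x => e (f x)) (f ⁻¹' e.source)

/-- The curve `η : [0,1] → G` in a manifold is smooth. -/
def IsSmoothCurve (η : I → G) : Prop :=
  Continuous η ∧ ∀ e ∈ atlas E G, IsSmoothCurveOn 𝕜 (fun t => e (η t)) (η ⁻¹' e.source)

variable [Group G]

/- As for Mathlib's `TangentSpace`, the tangent space `T_g G` is the model space `E`: a curve `η`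
through `g` is identified with its velocity in the preferred chart `chartAt E g`.
In particular, `Lie(G) = T_1 G` is `E`, identified by means of `chartAt E 1`. -/

/-- `w ∈ T_g G` is `g · v = (T_1 λ_g)(v)`, for `v ∈ Lie(G)` and the left translation
`λ_g : x ↦ g x`. -/
def IsLeftTranslate (g : G) (v w : E) : Prop :=
  HasDirDerivAt 𝕜 (fun x => chartAt E g (g * (chartAt E (1 : G)).symm x))
    (chartAt E (1 : G) 1) v w

/-- The linear map `L` is the tangent map `Lie(f) = T_1 f : Lie(G) → Lie(G')` of the
homomorphism `f`. -/
def IsTangentMap {E' : Type*} [AddCommGroup E'] [Module 𝕜 E'] [TopologicalSpace E']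
    {G' : Type*} [TopologicalSpace G'] [ChartedSpace E' G'] [Group G']
    (f : G →* G') (L : E →ₗ[𝕜] E') : Prop :=
  ∀ v : E, HasDirDerivAt 𝕜 (fun x => chartAt E' (1 : G') (f ((chartAt E (1 : G)).symm x)))
    (chartAt E (1 : G) 1) v (L v)

variable {E}
variable [IsTopologicalAddGroup E] [ContinuousSMul 𝕜 E]

/-- `η : [0,1] → G` is a product integral of `γ ∈ C^∞([0,1], Lie(G))`: it is smooth, `η(0) = 1`,
and `η'(t) = η(t) · γ(t)` in `T_{η(t)} G` for all `t ∈ [0,1]`. -/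
def IsProductIntegral (γ : SmoothCurve 𝕜 E) (η : I → G) : Prop :=
  IsSmoothCurve 𝕜 E η ∧ η 0 = 1 ∧
    ∀ t : I, ∃ w : E, HasCurveDerivAt 𝕜 (fun s => chartAt E (η t) (η s)) w t ∧
      IsLeftTranslate 𝕜 E (η t) (γ t) w

variable (E G)

open Classical in
/-- The evolution map `evol_G : C^∞([0,1], Lie(G)) → G`, `γ ↦ η_γ(1)`, where `η_γ` is the product
integral of `γ` (with value `1` if there is none). -/
def evol (γ : SmoothCurve 𝕜 E) : G :=
  if h : ∃ η : I → G, IsProductIntegral 𝕜 γ η then h.choose 1 else 1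

/-- Regularity in Milnor's sense: every smooth curve in `Lie(G)` has a product integral and the
evolution map is smooth. -/
def IsRegular : Prop :=
  (∀ γ : SmoothCurve 𝕜 E, ∃ η : I → G, IsProductIntegral 𝕜 γ η) ∧ IsSmoothMap 𝕜 E (evol 𝕜 E G)

end LieGroup

/-! ### Box topologies, direct sums -/

section Box

variable {ι : Type*}

/-- The box topology on a full product. -/
@[reducible] def boxTopology (X : ι → Type*) [∀ i, TopologicalSpace (X i)] : TopologicalSpace (∀ i, X i) :=
  TopologicalSpace.generateFrom
    {s | ∃ U : ∀ i, Set (X i), (∀ i, IsOpen (U i)) ∧ s = {x | ∀ i, x i ∈ U i}}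

theorem mem_nhds_induced_box {X : ι → Type*} [∀ i, TopologicalSpace (X i)] {A : Type*}
    (c : A → ∀ i, X i) (a : A) (s : Set A) :
    s ∈ @nhds A (TopologicalSpace.induced c (boxTopology X)) a ↔
      ∃ U : ∀ i, Set (X i), (∀ i, IsOpen (U i)) ∧ (∀ i, c a i ∈ U i) ∧
        {b | ∀ i, c b i ∈ U i} ⊆ s := by
  let _ := boxTopology X
  have hb : TopologicalSpace.IsTopologicalBasis
      {s : Set (∀ i, X i) | ∃ U : ∀ i, Set (X i), (∀ i, IsOpen (U i)) ∧
        s = {x | ∀ i, x i ∈ U i}} := by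
    refine ⟨?_, ?_, rfl⟩
    · rintro _ ⟨U, hU, rfl⟩ _ ⟨V, hV, rfl⟩ x hx
      exact ⟨_, ⟨fun i => U i ∩ V i, fun i => (hU i).inter (hV i), rfl⟩,
        fun i => ⟨hx.1 i, hx.2 i⟩, fun y hy => ⟨fun i => (hy i).1, fun i => (hy i).2⟩⟩
    · exact eq_univ_of_forall fun x =>
        ⟨_, ⟨fun _ => univ, fun _ => isOpen_univ, rfl⟩, fun _ => mem_univ _⟩
  rw [nhds_induced, mem_comap]
  constructor
  · rintro ⟨t, ht, hts⟩
    obtain ⟨_, ⟨U, hU, rfl⟩, hx, hUt⟩ := hb.mem_nhds_iff.1 ht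
    exact ⟨U, hU, hx, fun b hb => hts (hUt hb)⟩
  · rintro ⟨U, hU, hx, h⟩
    exact ⟨_, hb.mem_nhds_iff.2 ⟨_, ⟨U, hU, rfl⟩, hx, subset_rfl⟩, h⟩

theorem isOpen_induced_box {X : ι → Type*} [∀ i, TopologicalSpace (X i)] {A : Type*}
    (c : A → ∀ i, X i) (U : ∀ i, Set (X i)) (hU : ∀ i, IsOpen (U i)) :
    IsOpen[TopologicalSpace.induced c (boxTopology X)] {b | ∀ i, c b i ∈ U i} := by
  let _ := TopologicalSpace.induced c (boxTopology X)
  exact isOpen_iff_mem_nhds.2 fun a ha =>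
    (mem_nhds_induced_box c a _).2 ⟨U, hU, ha, subset_rfl⟩

variable {E : ι → Type*} [∀ i, AddCommGroup (E i)] [∀ i, TopologicalSpace (E i)]

/-- The direct sum carries the box topology. -/
instance directSumTopology : TopologicalSpace (⨁ i, E i) :=
  TopologicalSpace.induced (fun x i => x i) (boxTopology E)

theorem mem_nhds_directSum (x : ⨁ i, E i) (s : Set (⨁ i, E i)) :
    s ∈ 𝓝 x ↔ ∃ U : ∀ i, Set (E i), (∀ i, IsOpen (U i)) ∧ (∀ i, x i ∈ U i) ∧
      {y : ⨁ i, E i | ∀ i, y i ∈ U i} ⊆ s :=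
  mem_nhds_induced_box (fun (x : ⨁ i, E i) i => x i) x s

instance directSum_isTopologicalAddGroup [∀ i, IsTopologicalAddGroup (E i)] :
    IsTopologicalAddGroup (⨁ i, E i) where
  continuous_add := by
    refine continuous_iff_continuousAt.2 fun p s hs => ?_
    obtain ⟨U, hU, hx, hs⟩ := (mem_nhds_directSum _ _).1 hs
    have h : ∀ i, ∃ V W : Set (E i), IsOpen V ∧ IsOpen W ∧ p.1 i ∈ V ∧ p.2 i ∈ W ∧
        ∀ a ∈ V, ∀ b ∈ W, a + b ∈ U i := fun i => by
      obtain ⟨V, W, hV, hW, h1, h2, h⟩ := isOpen_prod_iff.1 ((hU i).preimage continuous_add)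
        (p.1 i) (p.2 i) (by simpa using hx i)
      exact ⟨V, W, hV, hW, h1, h2, fun a ha b hb => h (mk_mem_prod ha hb)⟩
    choose V W hV hW h1 h2 h using h
    rw [mem_map, nhds_prod_eq]
    refine mem_of_superset (prod_mem_prod ((mem_nhds_directSum _ _).2 ⟨V, hV, h1, subset_rfl⟩)
      ((mem_nhds_directSum _ _).2 ⟨W, hW, h2, subset_rfl⟩)) fun q hq => hs fun i => ?_
    simpa using h i _ (hq.1 i) _ (hq.2 i)
  continuous_neg := by
    refine continuous_iff_continuousAt.2 fun x s hs => ?_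
    obtain ⟨U, hU, hx, hs⟩ := (mem_nhds_directSum _ _).1 hs
    refine (mem_nhds_directSum _ _).2 ⟨fun i => -(U i), fun i => (hU i).neg, fun i => ?_,
      fun y hy => hs fun i => ?_⟩
    · exact hx i
    · exact hy i

instance directSum_continuousSMul {𝕜 : Type*} [RCLike 𝕜] [∀ i, Module 𝕜 (E i)]
    [∀ i, IsTopologicalAddGroup (E i)] [∀ i, ContinuousSMul 𝕜 (E i)] :
    ContinuousSMul 𝕜 (⨁ i, E i) := by
  classical
  refine ContinuousSMul.of_nhds_zero ?_ ?_ ?_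
  · intro s hs
    obtain ⟨U, hU, hx, hs⟩ := (mem_nhds_directSum _ _).1 hs
    have h : ∀ i, ∃ V : Set (E i), IsOpen V ∧ (0 : E i) ∈ V ∧
        ∀ c : 𝕜, ‖c‖ ≤ 1 → ∀ v ∈ V, c • v ∈ U i := fun i => by
      obtain ⟨B, ⟨hB, hBb⟩, hBU⟩ := (nhds_basis_balanced 𝕜 (E i)).mem_iff.1
        ((hU i).mem_nhds (by simpa using hx i))
      obtain ⟨V, hVB, hV, h0⟩ := mem_nhds_iff.1 hB
      exact ⟨V, hV, h0, fun c hc v hv => hBU (hBb.smul_mem hc (hVB hv))⟩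
    choose V hV h0 h using h
    rw [mem_map]
    refine mem_of_superset (prod_mem_prod (Metric.closedBall_mem_nhds (0 : 𝕜) one_pos)
      ((mem_nhds_directSum (0 : ⨁ i, E i) _).2 ⟨V, hV, h0, subset_rfl⟩)) fun q hq => hs fun i => ?_
    have := h i q.1 (by simpa using hq.1) _ (hq.2 i)
    simpa [DirectSum.smul_apply] using this
  · intro x s hs
    obtain ⟨U, hU, hx, hs⟩ := (mem_nhds_directSum _ _).1 hs
    have h : ∀ i ∈ DFinsupp.support x, ∀ᶠ c : 𝕜 in 𝓝 0, c • x i ∈ U i := fun i _ => by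
      have hc : ContinuousAt (fun c : 𝕜 => c • x i) 0 := by fun_prop
      exact hc ((hU i).mem_nhds (by simpa using hx i))
    rw [mem_map]
    refine mem_of_superset ((Filter.eventually_all_finset (DFinsupp.support x)).2 h) fun c hc => ?_
    refine hs fun i => ?_
    by_cases hi : i ∈ DFinsupp.support x
    · simpa [DirectSum.smul_apply] using hc i hi
    · have hi' : x i = 0 := by simpa using hi
      simpa [DirectSum.smul_apply, hi'] using hx i
  · intro c s hs
    obtain ⟨U, hU, hx, hs⟩ := (mem_nhds_directSum _ _).1 hs
    refine (mem_nhds_directSum _ _).2 ⟨fun i => (fun v => c • v) ⁻¹' U i,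
      fun i => (hU i).preimage (continuous_const_smul c), fun i => ?_, fun y hy => hs fun i => ?_⟩
    · simpa using hx i
    · simpa [DirectSum.smul_apply] using hy i

end Box

/-! ### Weak direct products -/

section WeakDirectProduct

variable {ι : Type*}

/-- The elements of `∏ H_i` with only finitely many non-trivial components. -/
def weakDirectProductSubgroup (H : ι → Type*) [∀ i, Group (H i)] : Subgroup (∀ i, H i) where
  carrier := {x | {i | x i ≠ 1}.Finite}
  one_mem' := by simp
  mul_mem' := by
    intro a b ha hb
    refine (ha.union hb).subset fun i hi => ?_
    by_contra hcon
    simp only [mem_union, mem_ofPred_eq, not_or, not_not] at hcon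
    exact hi (by simp [hcon.1, hcon.2])
  inv_mem' := by
    intro a ha
    simpa using ha

/-- The weak direct product `∏* H_i`; it is a type of its own, since its topology is not induced by
the product topology. -/
def WeakDirectProduct (H : ι → Type*) [∀ i, Group (H i)] : Type _ := ↥(weakDirectProductSubgroup H)

namespace WeakDirectProduct

variable (H : ι → Type*) [∀ i, Group (H i)]

instance : Group (WeakDirectProduct H) := inferInstanceAs (Group ↥(weakDirectProductSubgroup H))

instance : CoeFun (WeakDirectProduct H) (fun _ => ∀ i, H i) := ⟨fun x => x.1⟩

/-- The weak direct product carries the box topology. -/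
instance [∀ i, TopologicalSpace (H i)] : TopologicalSpace (WeakDirectProduct H) :=
  TopologicalSpace.induced (fun x i => x i) (boxTopology H)

variable {H}

theorem mem_nhds [∀ i, TopologicalSpace (H i)] (x : WeakDirectProduct H)
    (s : Set (WeakDirectProduct H)) :
    s ∈ 𝓝 x ↔ ∃ U : ∀ i, Set (H i), (∀ i, IsOpen (U i)) ∧ (∀ i, x i ∈ U i) ∧
      {y : WeakDirectProduct H | ∀ i, y i ∈ U i} ⊆ s :=
  mem_nhds_induced_box (fun (x : WeakDirectProduct H) i => x i) x s

theorem finite_ne_one (x : WeakDirectProduct H) : {i | x i ≠ 1}.Finite := x.2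

@[ext]
theorem ext {x y : WeakDirectProduct H} (h : ∀ i, x i = y i) : x = y := Subtype.ext (funext h)

variable (H) in
/-- The inclusion of the factor `H i`. -/
def inclusion [DecidableEq ι] (i : ι) : H i →* WeakDirectProduct H where
  toFun h := ⟨Pi.mulSingle i h, (Set.finite_singleton i).subset fun j hj => by
    by_contra hcon
    exact hj (Pi.mulSingle_eq_of_ne hcon h)⟩
  map_one' := Subtype.ext (Pi.mulSingle_one i)
  map_mul' a b := Subtype.ext (Pi.mulSingle_mul (f := H) i a b)

section Charts

variable {E : ι → Type*} [∀ i, AddCommGroup (E i)] [∀ i, TopologicalSpace (E i)]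
  [∀ i, TopologicalSpace (H i)] [∀ i, ChartedSpace (E i) (H i)]

/-- The preferred chart of a manifold at `g`, translated such that `g` is mapped to `0`. -/
def centredChart (E : Type*) [AddCommGroup E] [TopologicalSpace E] [IsTopologicalAddGroup E]
    {G : Type*} [TopologicalSpace G] [ChartedSpace E G] (g : G) : OpenPartialHomeomorph G E :=
  (chartAt E g).transHomeomorph (Homeomorph.addRight (-(chartAt E g g)))

variable [∀ i, IsTopologicalAddGroup (E i)]

theorem centredChart_self {E : Type*} [AddCommGroup E] [TopologicalSpace E]
    [IsTopologicalAddGroup E] {G : Type*} [TopologicalSpace G] [ChartedSpace E G] (g : G) :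
    centredChart E g g = 0 := by
  simp [centredChart]

theorem centredChart_symm_zero {E : Type*} [AddCommGroup E] [TopologicalSpace E]
    [IsTopologicalAddGroup E] {G : Type*} [TopologicalSpace G] [ChartedSpace E G] (g : G) :
    (centredChart E g).symm 0 = g := by
  rw [← centredChart_self (E := E) g]
  exact (centredChart E g).left_inv (by simp [centredChart])

variable (E)

theorem finite_chart (x y : WeakDirectProduct H) :
    {i | centredChart (E i) (x i) (y i) ≠ 0}.Finite := by
  refine (x.finite_ne_one.union y.finite_ne_one).subset fun i hi => ?_
  by_contra hcon
  simp only [mem_union, mem_ofPred_eq, not_or, not_not] at hcon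
  exact hi (by rw [hcon.1, hcon.2, centredChart_self])

variable [DecidableEq ι]

/-- The chart around `x`, `(y_i) ↦ (φ_i(y_i))` with `φ_i` the centred chart of `H i` at `x_i`. -/
def toDirectSum (x y : WeakDirectProduct H) : ⨁ i, E i :=
  DFinsupp.mk (finite_chart E x y).toFinset fun i => centredChart (E i) (x i) (y i)

theorem toDirectSum_apply (x y : WeakDirectProduct H) (i : ι) :
    toDirectSum E x y i = centredChart (E i) (x i) (y i) := by
  refine (DFinsupp.mk_apply ..).trans ?_
  split_ifs with h
  · rfl
  · simpa [eq_comm] using h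

/-- The inverse of the chart around `x`, `(v_i) ↦ (φ_i⁻¹(v_i))`. -/
def ofDirectSum (x : WeakDirectProduct H) (v : ⨁ i, E i) : WeakDirectProduct H :=
  ⟨fun i => (centredChart (E i) (x i)).symm (v i), by
    classical
    refine (x.finite_ne_one.union (DFinsupp.support v).finite_toSet).subset fun i hi => ?_
    by_contra hcon
    simp only [mem_union, mem_ofPred_eq, not_or, not_not, Finset.mem_coe,
      DFinsupp.mem_support_toFun] at hcon
    have h2 : v i = 0 := hcon.2
    refine hi ?_
    change (centredChart (E i) (x i)).symm (v i) = 1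
    rw [h2, centredChart_symm_zero, hcon.1]⟩

/-- The chart `⊕ φ_i` of the weak direct product around `x`, where `φ_i` is the centred chart of
`H i` at `x_i`. Its domain is the box of the domains of the `φ_i`, and its range is the box of their
ranges. -/
def boxChart (x : WeakDirectProduct H) : OpenPartialHomeomorph (WeakDirectProduct H) (⨁ i, E i) where
  toFun := toDirectSum E x
  invFun := ofDirectSum E x
  source := {y | ∀ i, y i ∈ (centredChart (E i) (x i)).source}
  target := {v | ∀ i, v i ∈ (centredChart (E i) (x i)).target}
  map_source' y hy i := by
    rw [toDirectSum_apply]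
    exact (centredChart (E i) (x i)).map_source (hy i)
  map_target' v hv i := (centredChart (E i) (x i)).map_target (hv i)
  left_inv' y hy := by
    ext i
    change (centredChart (E i) (x i)).symm (toDirectSum E x y i) = y i
    rw [toDirectSum_apply]
    exact (centredChart (E i) (x i)).left_inv (hy i)
  right_inv' v hv := by
    refine DFinsupp.ext fun i => (toDirectSum_apply E x _ i).trans ?_
    exact (centredChart (E i) (x i)).right_inv (hv i)
  open_source := isOpen_induced_box (fun (y : WeakDirectProduct H) i => y i) _
    fun i => (centredChart (E i) (x i)).open_source
  open_target := isOpen_induced_box (fun (v : ⨁ i, E i) i => v i) _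
    fun i => (centredChart (E i) (x i)).open_target
  continuousOn_toFun := fun y hy => ContinuousAt.continuousWithinAt fun s hs => by
    obtain ⟨U, hU, hx, hs⟩ := (mem_nhds_directSum _ _).1 hs
    refine (mem_nhds _ _).2 ⟨fun i => (centredChart (E i) (x i)).source ∩
      centredChart (E i) (x i) ⁻¹' U i,
      fun i => (centredChart (E i) (x i)).isOpen_inter_preimage (hU i), fun i => ⟨hy i, ?_⟩,
      fun z hz => hs fun i => ?_⟩
    · have := hx i
      rwa [toDirectSum_apply] at this
    · rw [toDirectSum_apply]
      exact (hz i).2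
  continuousOn_invFun := fun v hv => ContinuousAt.continuousWithinAt fun s hs => by
    obtain ⟨U, hU, hx, hs⟩ := (mem_nhds _ _).1 hs
    exact (mem_nhds_directSum _ _).2 ⟨fun i => (centredChart (E i) (x i)).target ∩
      (centredChart (E i) (x i)).symm ⁻¹' U i,
      fun i => (centredChart (E i) (x i)).isOpen_inter_preimage_symm (hU i),
      fun i => ⟨hv i, hx i⟩, fun z hz => hs fun i => (hz i).2⟩

/-- The manifold structure on the weak direct product, modelled on the direct sum. -/
instance : ChartedSpace (⨁ i, E i) (WeakDirectProduct H) where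
  atlas := range (boxChart E)
  chartAt := boxChart E
  mem_chart_source x i := by simp [centredChart]
  chart_mem_atlas x := mem_range_self x

end Charts

end WeakDirectProduct

end WeakDirectProduct

end LCLie

end

noncomputable section

set_option linter.unusedSectionVars false

namespace LCLie

/-! ### Mean value estimates and the chain rule in locally convex spaces -/

section Chain

variable {𝕜 : Type*} [RCLike 𝕜]
variable {E : Type*} [AddCommGroup E] [Module 𝕜 E] [TopologicalSpace E]
  [IsTopologicalAddGroup E] [ContinuousSMul 𝕜 E]
variable {F : Type*} [AddCommGroup F] [Module 𝕜 F] [TopologicalSpace F]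
  [IsTopologicalAddGroup F] [ContinuousSMul 𝕜 F]

/-! Existence. A compact subset of a direct sum with the box topology lies in a finite partial sum
(`finite_support_of_isCompact`): given infinitely many active coordinates, a box could exclude all
but finitely many chosen witnesses. Hence a smooth curve over `[0,1]` involves only finitely many
factors. It can be integrated componentwise (`isMackeyComplete_directSum`), and product integrals in
these factors, completed by the constant `1` in the others, form a product integral in the weak
direct product (`exists_isProductIntegral`). The Lie group axioms are also checked componentwise,
through `isSmoothOn_directSum`.

Discontinuity. A neighbourhood of `0` in the `C^∞`-topology controls derivatives only up to some
finite order `K`, whereas a box may impose conditions on all factors at once. Choose for each `n` an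
identity neighbourhood `V n` whose preimage under `evol` of `H n` is not a `C^n`-neighbourhood of
`0`. If `evol` of the product were continuous at `0`, the preimage of the box of the `V n` would
contain a set given by some order `K`; restricting to curves in one summand with `n ≥ K` contradicts
the choice of `V n` (`not_continuous_evol`).

This requires discontinuity at `0`, while the hypothesis only gives discontinuity somewhere. The gap
is closed by `continuous_evol_of_tendsto`, which rests on the identity `evol γ = evol (Ad(η)(γ - δ))
* evol δ`, with `η` the product integral of `δ` (`IsProductIntegral.mul`), and on the
`C^n`-continuity of `γ ↦ Ad(η)(γ - δ)`, obtained from `isParamC_adjoint`.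

The calculus underneath is the chain rule in locally convex spaces: the mean value inequality for
one continuous seminorm at a time gives `tendsto_slope`, from which multilinearity of differentials
and the velocity formulas `hasVelocity` and `hasVelocity_comp` follow. -/

theorem tendsto_of_tendsto_inv_smul_sub {ι : Type*} {l : Filter ι} {h : ι → 𝕜} {u : ι → E}
    {x w : E} (hh : Tendsto h l (𝓝[≠] 0))
    (hu : Tendsto (fun s => (h s)⁻¹ • (u s - x)) l (𝓝 w)) : Tendsto u l (𝓝 x) := by
  have h0 := (tendsto_nhdsWithin_iff.1 hh).1
  have h1 := ((h0.smul hu).add_const x)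
  rw [zero_smul, zero_add] at h1
  refine h1.congr' ?_
  filter_upwards [(tendsto_nhdsWithin_iff.1 hh).2] with s hs
  rw [smul_smul, mul_inv_cancel₀ hs, one_smul, sub_add_cancel]

theorem tendsto_ofReal_sub (x : ℝ) :
    Tendsto (fun z : ℝ => ((z - x : ℝ) : 𝕜)) (𝓝[≠] x) (𝓝[≠] 0) := by
  refine tendsto_nhdsWithin_iff.2 ⟨?_, ?_⟩
  · have : Continuous fun z : ℝ => ((z - x : ℝ) : 𝕜) :=
      RCLike.continuous_ofReal.comp (continuous_id.sub continuous_const)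
    have h2 := this.tendsto x
    simp only [sub_self, RCLike.ofReal_zero] at h2
    exact h2.mono_left nhdsWithin_le_nhds
  · filter_upwards [self_mem_nhdsWithin] with z hz
    exact RCLike.ofReal_ne_zero.2 (sub_ne_zero.2 hz)

theorem tendsto_add_smul (x y : E) : Tendsto (fun t : 𝕜 => x + t • y) (𝓝[≠] 0) (𝓝 x) := by
  have : Continuous fun t : 𝕜 => x + t • y := by fun_prop
  have h2 := this.tendsto 0
  rw [zero_smul, add_zero] at h2
  exact h2.mono_left nhdsWithin_le_nhds

/-- Mean value inequality for a continuous seminorm. -/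
theorem seminorm_sub_le (p : Seminorm 𝕜 F) (hp : Continuous p) {φ φ' : ℝ → F} {a b C : ℝ}
    (hab : a ≤ b)
    (hφ : ∀ x ∈ Icc a b, Tendsto (fun z : ℝ => ((z - x : ℝ) : 𝕜)⁻¹ • (φ z - φ x))
      (𝓝[Icc a b \ {x}] x) (𝓝 (φ' x)))
    (hC : ∀ x ∈ Icc a b, p (φ' x) ≤ C) : p (φ b - φ a) ≤ C * (b - a) := by
  have hcont : ContinuousOn φ (Icc a b) := fun x hx => by
    rw [← continuousWithinAt_sdiff_self]
    refine tendsto_of_tendsto_inv_smul_sub (𝕜 := 𝕜) (h := fun z : ℝ => ((z - x : ℝ) : 𝕜)) ?_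
      (hφ x hx)
    exact (tendsto_ofReal_sub x).mono_left (nhdsWithin_mono _ fun z hz => hz.2)
  -- The scalar function `p (φ z - φ a)` need not be differentiable. Comparing it with `C * (z - a)`
  -- only requires a bound on its right-hand slopes, which the triangle inequality reduces to `p` of
  -- the difference quotients of `φ`.
  have key := image_le_of_liminf_slope_right_le_deriv_boundary
    (f := fun z => p (φ z - φ a)) (a := a) (b := b) (B := fun z => C * (z - a)) (B' := fun _ => C)
    (hp.comp_continuousOn (hcont.sub continuousOn_const)) (by simp)
    (by fun_prop) (fun x _ => by
      simpa using (((hasDerivWithinAt_id x (Ici x)).sub_const a).const_mul C)) ?_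
  · exact key ⟨hab, le_rfl⟩
  · intro x hx r hr
    have hx' : x ∈ Icc a b := ⟨hx.1, hx.2.le⟩
    have hle : 𝓝[>] x ≤ 𝓝[Icc a b \ {x}] x := by
      rw [nhdsWithin_le_iff]
      filter_upwards [Ioo_mem_nhdsGT hx.2] with z hz
      exact ⟨⟨hx.1.trans hz.1.le, hz.2.le⟩, hz.1.ne'⟩
    have h1 := (hp.tendsto _).comp ((hφ x hx').mono_left hle)
    have h2 : ∀ᶠ z in 𝓝[>] x, p (((z - x : ℝ) : 𝕜)⁻¹ • (φ z - φ x)) < r :=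
      h1.eventually (gt_mem_nhds ((hC x hx').trans_lt hr))
    refine Eventually.frequently ?_
    filter_upwards [h2, self_mem_nhdsWithin] with z hz hxz
    have hpos : 0 < z - x := sub_pos.2 hxz
    rw [map_smul_eq_mul, norm_inv, RCLike.norm_ofReal, abs_of_pos hpos] at hz
    rw [slope_def_field]
    refine lt_of_le_of_lt ?_ hz
    rw [div_eq_inv_mul]
    gcongr
    have := map_add_le_add p (φ z - φ x) (φ x - φ a)
    rw [sub_add_sub_cancel] at this
    linarith

theorem HasDirDerivAt.smul_right {f : E → F} {x y : E} {v : F} (h : HasDirDerivAt 𝕜 f x y v)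
    (c : 𝕜) : HasDirDerivAt 𝕜 f x (c • y) (c • v) := by
  rcases eq_or_ne c 0 with rfl | hc
  · simp [HasDirDerivAt, tendsto_const_nhds]
  · have h1 : Tendsto (fun t : 𝕜 => t * c) (𝓝[≠] 0) (𝓝[≠] 0) := by
      refine tendsto_nhdsWithin_iff.2 ⟨?_, ?_⟩
      · have : Continuous fun t : 𝕜 => t * c := by fun_prop
        have h2 := this.tendsto 0
        rw [zero_mul] at h2
        exact h2.mono_left nhdsWithin_le_nhds
      · filter_upwards [self_mem_nhdsWithin] with t ht
        exact mul_ne_zero ht hc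
    refine ((h.comp h1).const_smul c).congr fun t => ?_
    simp only [Function.comp_apply, smul_smul, mul_inv]
    rw [mul_comm, mul_assoc, inv_mul_cancel₀ hc, mul_one]

theorem hasDirDerivAt_unique [T2Space F] {f : E → F} {x y : E} {v w : F}
    (h : HasDirDerivAt 𝕜 f x y v) (h' : HasDirDerivAt 𝕜 f x y w) : v = w :=
  tendsto_nhds_unique h h'

/-- A family of `C^1`-maps with jointly continuous differential: difference quotients with moving
parameter, base point and direction converge. -/
theorem tendsto_slope [PolynormableSpace 𝕜 F] {ι Y : Type*} {l : Filter ι} [TopologicalSpace Y]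
    {g : Y → E → F} {dg : Y → E → E → F} {U : Set E} (hU : IsOpen U)
    (hg : ∀ y, ∀ x ∈ U, ∀ v, HasDirDerivAt 𝕜 (g y) x v (dg y x v))
    {y₀ : Y} {x₀ w : E} (hx₀ : x₀ ∈ U)
    (hc : ContinuousAt (fun q : Y × E × E => dg q.1 q.2.1 q.2.2) (y₀, x₀, w))
    {h : ι → 𝕜} {y : ι → Y} {x q : ι → E} (hh : Tendsto h l (𝓝[≠] 0))
    (hy : Tendsto y l (𝓝 y₀)) (hx : Tendsto x l (𝓝 x₀)) (hq : Tendsto q l (𝓝 w)) :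
    Tendsto (fun s => (h s)⁻¹ • (g (y s) (x s + h s • q s) - g (y s) (x s))) l
      (𝓝 (dg y₀ x₀ w)) := by
  -- Convergence is tested on one continuous seminorm at a time, where the mean value inequality
  -- applies.
  rw [(PolynormableSpace.withSeminorms 𝕜 F).tendsto_nhds]
  rintro ⟨p, hp⟩ ε hε
  have h0 := (tendsto_nhdsWithin_iff.1 hh).1
  -- The filter `l ×ˢ 𝓟 (Icc 0 1)` encodes uniformity in `r ∈ [0,1]`: the whole segment from `x s`
  -- to `x s + h s • q s` shrinks to `x₀`.
  have hbase : Tendsto (fun z : ι × ℝ => x z.1 + ((z.2 : ℝ) : 𝕜) • h z.1 • q z.1)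
      (l ×ˢ 𝓟 (Icc 0 1)) (𝓝 x₀) := by
    have h1 : Tendsto (fun z : ι × ℝ => ((z.2 : ℝ) : 𝕜) * h z.1) (l ×ˢ 𝓟 (Icc 0 1)) (𝓝 0) := by
      rw [tendsto_zero_iff_norm_tendsto_zero]
      refine squeeze_zero' (Eventually.of_forall fun _ => norm_nonneg _) ?_
        ((tendsto_zero_iff_norm_tendsto_zero.1 h0).comp tendsto_fst)
      refine (eventually_prod_principal_iff).2 (Eventually.of_forall fun s r hr => ?_)
      simp only [norm_mul, RCLike.norm_ofReal, Function.comp_apply, abs_of_nonneg hr.1]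
      exact mul_le_of_le_one_left (norm_nonneg _) hr.2
    have h2 := (hx.comp tendsto_fst).add (h1.smul (hq.comp tendsto_fst))
    rw [zero_smul, add_zero] at h2
    refine h2.congr fun z => ?_
    simp [smul_smul]
  have hd : Tendsto (fun z : ι × ℝ =>
      dg (y z.1) (x z.1 + ((z.2 : ℝ) : 𝕜) • h z.1 • q z.1) (q z.1))
      (l ×ˢ 𝓟 (Icc 0 1)) (𝓝 (dg y₀ x₀ w)) :=
    hc.tendsto.comp ((hy.comp tendsto_fst).prodMk_nhds (hbase.prodMk_nhds (hq.comp tendsto_fst)))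
  have e1 : ∀ᶠ s in l, ∀ r ∈ Icc (0 : ℝ) 1,
      p (dg (y s) (x s + (r : 𝕜) • h s • q s) (q s) - dg y₀ x₀ w) < ε / 2 := by
    refine (eventually_prod_principal_iff (p := fun z : ι × ℝ =>
      p (dg (y z.1) (x z.1 + ((z.2 : ℝ) : 𝕜) • h z.1 • q z.1) (q z.1) - dg y₀ x₀ w) < ε / 2)).1 ?_
    have := (hp.tendsto _).comp (hd.sub_const (dg y₀ x₀ w))
    rw [sub_self, map_zero] at this
    exact this.eventually (gt_mem_nhds (half_pos hε))
  have e2 : ∀ᶠ s in l, ∀ r ∈ Icc (0 : ℝ) 1, x s + (r : 𝕜) • h s • q s ∈ U :=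
    (eventually_prod_principal_iff).1 (hbase.eventually (hU.mem_nhds hx₀))
  filter_upwards [e1, e2, (tendsto_nhdsWithin_iff.1 hh).2] with s h1 h2 hs
  set D := dg y₀ x₀ w
  -- With the linear part removed, the derivative along the segment is `h s` times a vector of
  -- seminorm below `ε / 2`; the factor `‖h s‖` cancels against the quotient.
  let φ : ℝ → F := fun r => g (y s) (x s + (r : 𝕜) • h s • q s) - (r : 𝕜) • h s • D
  let φ' : ℝ → F := fun r => h s • (dg (y s) (x s + (r : 𝕜) • h s • q s) (q s) - D)
  have hmv := seminorm_sub_le p hp (φ := φ) (φ' := φ') (C := ‖h s‖ * (ε / 2)) zero_le_one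
    (fun r hr => ?_) (fun r hr => ?_)
  · have e : (h s)⁻¹ • (g (y s) (x s + h s • q s) - g (y s) (x s)) - D = (h s)⁻¹ • (φ 1 - φ 0) := by
      simp only [φ, RCLike.ofReal_one, one_smul, RCLike.ofReal_zero, zero_smul, add_zero, sub_zero]
      rw [sub_right_comm, smul_sub _ _ (h s • D), smul_smul _ _ D, inv_mul_cancel₀ hs, one_smul]
    change p _ < ε
    rw [e, map_smul_eq_mul, norm_inv]
    have hpos : 0 < ‖h s‖ := norm_pos_iff.2 hs
    rw [sub_zero, mul_one] at hmv
    calc ‖h s‖⁻¹ * p (φ 1 - φ 0) ≤ ‖h s‖⁻¹ * (‖h s‖ * (ε / 2)) := by gcongr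
      _ = ε / 2 := by field_simp
      _ < ε := half_lt_self hε
  · have hder := (hg (y s) _ (h2 r hr) (q s)).smul_right (h s)
    have ht : Tendsto (fun z : ℝ => ((z - r : ℝ) : 𝕜)) (𝓝[Icc 0 1 \ {r}] r) (𝓝[≠] 0) :=
      (tendsto_ofReal_sub r).mono_left (nhdsWithin_mono _ fun z hz => hz.2)
    have h3 := (hder.comp ht).sub_const (h s • D)
    rw [← smul_sub] at h3
    refine h3.congr' ?_
    filter_upwards [(tendsto_nhdsWithin_iff.1 ht).2] with z hz
    simp only [Function.comp_apply, φ]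
    have hz' : ((z - r : ℝ) : 𝕜) ≠ 0 := hz
    have e1 : x s + (r : 𝕜) • h s • q s + ((z - r : ℝ) : 𝕜) • h s • q s
        = x s + (z : 𝕜) • h s • q s := by
      rw [add_assoc, ← add_smul]
      simp
    rw [e1, sub_sub_sub_comm, smul_sub _ _ ((z : 𝕜) • h s • D - _), ← sub_smul,
      ← RCLike.ofReal_sub, smul_smul _ _ (h s • D), inv_mul_cancel₀ hz', one_smul]
  · simp only [φ']
    rw [map_smul_eq_mul]
    exact mul_le_mul_of_nonneg_left (h1 r hr).le (norm_nonneg _)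

/-- The iterated directional derivatives of a smooth map: the data in `IsSmoothOn`. -/
structure IsDerivFamily (𝕜 : Type*) [RCLike 𝕜] {E : Type*} [AddCommGroup E] [Module 𝕜 E]
    [TopologicalSpace E] {F : Type*} [AddCommGroup F] [Module 𝕜 F] [TopologicalSpace F]
    (d : (k : ℕ) → E → (Fin k → E) → F) (f : E → F) (U : Set E) : Prop where
  zero : ∀ x ∈ U, ∀ y, d 0 x y = f x
  succ : ∀ k, ∀ x ∈ U, ∀ y : Fin (k + 1) → E,
      HasDirDerivAt 𝕜 (fun z => d k z (Fin.init y)) x (y (Fin.last k)) (d (k + 1) x y)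
  cont : ∀ k, ContinuousOn (fun p : E × (Fin k → E) => d k p.1 p.2) (U ×ˢ univ)

theorem isSmoothOn_iff {f : E → F} {U : Set E} :
    IsSmoothOn 𝕜 f U ↔ ∃ d, IsDerivFamily 𝕜 d f U :=
  ⟨fun ⟨d, h0, h1, h2⟩ => ⟨d, h0, h1, h2⟩, fun ⟨d, h⟩ => ⟨d, h.zero, h.succ, h.cont⟩⟩

/-! ### Multilinearity of iterated differentials and the chain rule along curves. -/

namespace IsDerivFamily

variable {d : (k : ℕ) → E → (Fin k → E) → F} {f : E → F} {U : Set E}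

theorem continuousAt (hd : IsDerivFamily 𝕜 d f U) (hU : IsOpen U) (k : ℕ) {x : E} (hx : x ∈ U)
    (y : Fin k → E) : ContinuousAt (fun p : E × (Fin k → E) => d k p.1 p.2) (x, y) :=
  (hd.cont k).continuousAt ((hU.prod isOpen_univ).mem_nhds ⟨hx, mem_univ _⟩)

theorem hasDirDerivAt_snoc (hd : IsDerivFamily 𝕜 d f U) {k : ℕ} {x : E} (hx : x ∈ U)
    (y : Fin k → E) (v : E) :
    HasDirDerivAt 𝕜 (fun z => d k z y) x v (d (k + 1) x (Fin.snoc y v)) := by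
  have := hd.succ k x hx (Fin.snoc y v)
  simpa using this

theorem tendsto_slope [PolynormableSpace 𝕜 F] (hd : IsDerivFamily 𝕜 d f U) (hU : IsOpen U)
    {ι : Type*} {l : Filter ι} {k : ℕ} {x₀ w : E} (hx₀ : x₀ ∈ U) {y₀ : Fin k → E}
    {h : ι → 𝕜} {y : ι → Fin k → E} {x q : ι → E} (hh : Tendsto h l (𝓝[≠] 0))
    (hy : Tendsto y l (𝓝 y₀)) (hx : Tendsto x l (𝓝 x₀)) (hq : Tendsto q l (𝓝 w)) :
    Tendsto (fun s => (h s)⁻¹ • (d k (x s + h s • q s) (y s) - d k (x s) (y s))) l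
      (𝓝 (d (k + 1) x₀ (Fin.snoc y₀ w))) := by
  refine LCLie.tendsto_slope (g := fun y x => d k x y)
    (dg := fun y x v => d (k + 1) x (Fin.snoc y v)) hU
    (fun y x hx v => hd.hasDirDerivAt_snoc hx y v) hx₀ ?_ hh hy hx hq
  have h1 : ContinuousAt (fun q : (Fin k → E) × E × E =>
      ((q.2.1, Fin.snoc q.1 q.2.2) : E × (Fin (k + 1) → E))) (y₀, x₀, w) := by
    refine Continuous.continuousAt (Continuous.prodMk (by fun_prop) ?_)
    exact Continuous.finSnoc continuous_fst (continuous_snd.comp continuous_snd)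
  exact ContinuousAt.comp (f := fun q : (Fin k → E) × E × E =>
      ((q.2.1, Fin.snoc q.1 q.2.2) : E × (Fin (k + 1) → E)))
      (g := fun p : E × (Fin (k + 1) → E) => d (k + 1) p.1 p.2)
    (hd.continuousAt hU (k + 1) hx₀ _) h1

/-- The step from `x` to `x + t (a + b)` is split at `x + t a`. The second quotient then has a
moving base point, which is exactly what `tendsto_slope` allows. -/
theorem snoc_add [PolynormableSpace 𝕜 F] [T2Space F] (hd : IsDerivFamily 𝕜 d f U) (hU : IsOpen U)
    {k : ℕ} {x : E} (hx : x ∈ U) (y : Fin k → E) (a b : E) :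
    d (k + 1) x (Fin.snoc y (a + b)) = d (k + 1) x (Fin.snoc y a) + d (k + 1) x (Fin.snoc y b) := by
  have h0 := tendsto_add_smul (𝕜 := 𝕜) x a
  have h1 := hd.tendsto_slope hU hx (l := 𝓝[≠] (0 : 𝕜)) (h := id) tendsto_id
    (tendsto_const_nhds (x := y)) h0 (tendsto_const_nhds (x := b))
  refine hasDirDerivAt_unique (hd.hasDirDerivAt_snoc hx y (a + b)) ?_
  refine ((hd.hasDirDerivAt_snoc hx y a).add h1).congr fun t => ?_
  simp only [id]
  rw [← smul_add, smul_add t, add_assoc]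
  congr 1
  abel

/-- Additivity in the last slot is `snoc_add`. In an earlier slot it holds for the differential of
order `k` at all points near `x` by induction, so it passes to the difference quotients and to their
limit. -/
theorem update_add [PolynormableSpace 𝕜 F] [T2Space F] (hd : IsDerivFamily 𝕜 d f U) (hU : IsOpen U)
    (k : ℕ) : ∀ {x : E}, x ∈ U → ∀ (y : Fin k → E) (j : Fin k) (a b : E),
    d k x (Function.update y j (a + b))
      = d k x (Function.update y j a) + d k x (Function.update y j b) := by
  induction k with
  | zero => intro x _ y j; exact j.elim0
  | succ k ih =>
    intro x hx y j a b
    induction j using Fin.lastCases with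
    | last =>
      have e : ∀ c, Function.update y (Fin.last k) c = Fin.snoc (Fin.init y) c := fun c => by
        rw [← Fin.update_snoc_last (α := fun _ => E) (y (Fin.last k)) (Fin.init y) c,
          Fin.snoc_init_self]
      simp only [e]
      exact hd.snoc_add hU hx _ a b
    | cast j =>
      have e : ∀ c, Function.update y j.castSucc c
          = Fin.snoc (Function.update (Fin.init y) j c) (y (Fin.last k)) := fun c => by
        rw [Fin.snoc_update, Fin.snoc_init_self]
      simp only [e]
      refine hasDirDerivAt_unique (hd.hasDirDerivAt_snoc hx _ _) ?_
      refine ((hd.hasDirDerivAt_snoc hx (Function.update (Fin.init y) j a) (y (Fin.last k))).add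
        (hd.hasDirDerivAt_snoc hx (Function.update (Fin.init y) j b) (y (Fin.last k)))).congr' ?_
      have h0 : ∀ᶠ t : 𝕜 in 𝓝[≠] 0, x + t • y (Fin.last k) ∈ U := 
        (tendsto_add_smul x _).eventually (hU.mem_nhds hx)
      filter_upwards [h0] with t ht
      rw [ih ht, ih hx, ← smul_add]
      congr 1
      abel

theorem update_smul [T2Space F] (hd : IsDerivFamily 𝕜 d f U) (hU : IsOpen U)
    (k : ℕ) : ∀ {x : E}, x ∈ U → ∀ (y : Fin k → E) (j : Fin k) (c : 𝕜) (a : E),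
    d k x (Function.update y j (c • a)) = c • d k x (Function.update y j a) := by
  induction k with
  | zero => intro x _ y j; exact j.elim0
  | succ k ih =>
    intro x hx y j c a
    induction j using Fin.lastCases with
    | last =>
      have e : ∀ c, Function.update y (Fin.last k) c = Fin.snoc (Fin.init y) c := fun c => by
        rw [← Fin.update_snoc_last (α := fun _ => E) (y (Fin.last k)) (Fin.init y) c,
          Fin.snoc_init_self]
      simp only [e]
      exact hasDirDerivAt_unique (hd.hasDirDerivAt_snoc hx _ _)
        ((hd.hasDirDerivAt_snoc hx _ _).smul_right c)
    | cast j =>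
      have e : ∀ c, Function.update y j.castSucc c
          = Fin.snoc (Function.update (Fin.init y) j c) (y (Fin.last k)) := fun c => by
        rw [Fin.snoc_update, Fin.snoc_init_self]
      simp only [e]
      refine hasDirDerivAt_unique (hd.hasDirDerivAt_snoc hx _ _) ?_
      refine ((hd.hasDirDerivAt_snoc hx (Function.update (Fin.init y) j a)
        (y (Fin.last k))).const_smul c).congr' ?_
      have h0 : ∀ᶠ t : 𝕜 in 𝓝[≠] 0, x + t • y (Fin.last k) ∈ U := 
        (tendsto_add_smul x _).eventually (hU.mem_nhds hx)
      filter_upwards [h0] with t ht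
      rw [ih ht, ih hx, ← smul_sub, smul_comm]

/-- The `k`-th differential at a point, as a multilinear map. -/
def multilinear [PolynormableSpace 𝕜 F] [T2Space F] (hd : IsDerivFamily 𝕜 d f U) (hU : IsOpen U)
    (k : ℕ) {x : E} (hx : x ∈ U) : MultilinearMap 𝕜 (fun _ : Fin k => E) F where
  toFun := d k x
  map_update_add' {inst} y j a b := by
    rw [Subsingleton.elim inst (instDecidableEqFin k)]
    exact hd.update_add hU k hx y j a b
  map_update_smul' {inst} y j c a := by
    rw [Subsingleton.elim inst (instDecidableEqFin k)]
    exact hd.update_smul hU k hx y j c a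

/-- Velocity of `s ↦ d^k f (u s) (y s)`. -/
theorem hasVelocity [PolynormableSpace 𝕜 F] [T2Space F] (hd : IsDerivFamily 𝕜 d f U)
    (hU : IsOpen U) {ι : Type*} {l : Filter ι} {k : ℕ} {x₀ w : E} (hx₀ : x₀ ∈ U)
    {y₀ v : Fin k → E} {h : ι → 𝕜} {y : ι → Fin k → E} {u : ι → E}
    (hh : Tendsto h l (𝓝[≠] 0))
    (hu : Tendsto (fun s => (h s)⁻¹ • (u s - x₀)) l (𝓝 w))
    (hy : ∀ j, Tendsto (fun s => (h s)⁻¹ • (y s j - y₀ j)) l (𝓝 (v j))) :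
    Tendsto (fun s => (h s)⁻¹ • (d k (u s) (y s) - d k x₀ y₀)) l
      (𝓝 (d (k + 1) x₀ (Fin.snoc y₀ w)
        + ∑ j, d k x₀ (Function.update y₀ j (v j)))) := by
  have hyt : Tendsto y l (𝓝 y₀) := tendsto_pi_nhds.2 fun j =>
    tendsto_of_tendsto_inv_smul_sub hh (hy j)
  have h1 := hd.tendsto_slope hU hx₀ hh hyt (tendsto_const_nhds (x := x₀)) hu
  -- The change of the directions is telescoped: in the `i`-th term the entries before `i` are
  -- already new, those after `i` still old, and entry `i` carries the difference quotient.
  -- Multilinearity at the fixed point `x₀` identifies the sum with the total quotient.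
  have h2 : Tendsto (fun s => ∑ i : Fin k, d k x₀ (fun j => if j < i then y s j else if i = j then
      (h s)⁻¹ • (y s j - y₀ j) else y₀ j)) l (𝓝 (∑ j, d k x₀ (Function.update y₀ j (v j)))) := by
    refine tendsto_finsetSum _ fun i _ => ?_
    have hc := (hd.continuousAt hU k hx₀ (Function.update y₀ i (v i))).tendsto
    refine Tendsto.comp (g := fun p : E × (Fin k → E) => d k p.1 p.2)
      (f := fun s => (x₀, fun j => if j < i then y s j else if i = j then
      (h s)⁻¹ • (y s j - y₀ j) else y₀ j)) hc (tendsto_const_nhds.prodMk_nhds ?_)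
    refine tendsto_pi_nhds.2 fun j => ?_
    by_cases hji : j < i
    · simpa only [hji, if_true, Function.update_of_ne hji.ne] using tendsto_pi_nhds.1 hyt j
    · by_cases hij : i = j
      · subst hij
        simpa using hy i
      · simpa only [hji, hij, if_false, Function.update_of_ne (Ne.symm hij)] using
          tendsto_const_nhds
  refine (h1.add h2).congr' ?_
  filter_upwards [(tendsto_nhdsWithin_iff.1 hh).2] with s hs
  have hs' : h s ≠ 0 := hs
  have e1 : x₀ + h s • (h s)⁻¹ • (u s - x₀) = u s := by
    rw [smul_smul, mul_inv_cancel₀ hs', one_smul, add_sub_cancel]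
  have e2 := (hd.multilinear hU k hx₀).map_sub_map_piecewise (y s) y₀ Finset.univ
  simp only [Finset.piecewise_univ, Finset.mem_univ, true_imp_iff] at e2
  have e3 : (h s)⁻¹ • (d k x₀ (y s) - d k x₀ y₀) =
      ∑ i : Fin k, d k x₀ (fun j => if j < i then y s j else if i = j then
      (h s)⁻¹ • (y s j - y₀ j) else y₀ j) := by
    change d k x₀ (y s) - d k x₀ y₀ = _ at e2
    rw [e2, Finset.smul_sum]
    refine Finset.sum_congr rfl fun i _ => ?_
    have e4 : ∀ c : E, (fun j => if j < i then y s j else if i = j then c else y₀ j)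
        = Function.update (fun j => if j < i then y s j else y₀ j) i c := fun c => by
      ext j
      by_cases hji : j = i
      · subst hji; simp
      · simp [Function.update_of_ne hji, Ne.symm hji]
    have e5 : ∀ z : Fin k → E, (fun j => if j < i then y s j else if i = j then z j else y₀ j)
        = (fun j => if j < i then y s j else if i = j then z i else y₀ j) := fun z => by
      ext j
      by_cases hji : i = j
      · subst hji; rfl
      · simp [hji]
    change (h s)⁻¹ • d k x₀ _ = _
    rw [e5 (fun j => y s j - y₀ j), e5 (fun j => (h s)⁻¹ • (y s j - y₀ j)), e4, e4,
      hd.update_smul hU k hx₀]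
  rw [e1, ← e3, ← smul_add, sub_add_sub_cancel]

/-- The chain rule along curves. -/
theorem hasVelocity_comp [PolynormableSpace 𝕜 F] (hd : IsDerivFamily 𝕜 d f U)
    (hU : IsOpen U) {ι : Type*} {l : Filter ι} {x₀ w : E} (hx₀ : x₀ ∈ U)
    {h : ι → 𝕜} {u : ι → E} (hh : Tendsto h l (𝓝[≠] 0))
    (hu : Tendsto (fun s => (h s)⁻¹ • (u s - x₀)) l (𝓝 w)) :
    Tendsto (fun s => (h s)⁻¹ • (f (u s) - f x₀)) l (𝓝 (d 1 x₀ (fun _ => w))) := by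
  have h1 := hd.tendsto_slope hU hx₀ hh (tendsto_const_nhds (x := Fin.elim0))
    (tendsto_const_nhds (x := x₀)) hu
  have e0 : (Fin.snoc Fin.elim0 w : Fin 1 → E) = fun _ => w := by
    ext j
    rw [Fin.fin_one_eq_zero j]
    exact Fin.snoc_last (α := fun _ => E) w Fin.elim0
  rw [e0] at h1
  refine h1.congr' ?_
  filter_upwards [(tendsto_nhdsWithin_iff.1 hh).2,
    (tendsto_of_tendsto_inv_smul_sub hh hu).eventually (hU.mem_nhds hx₀)] with s hs hsU
  have hs' : h s ≠ 0 := hs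
  have e1 : x₀ + h s • (h s)⁻¹ • (u s - x₀) = u s := by
    rw [smul_smul, mul_inv_cancel₀ hs', one_smul, add_sub_cancel]
  rw [e1, hd.zero _ hsU, hd.zero _ hx₀]

end IsDerivFamily

end Chain

/-! ### Curves depending on a parameter -/

section ParamCurve

variable {𝕜 : Type*} [RCLike 𝕜]
variable {E : Type*} [AddCommGroup E] [Module 𝕜 E] [TopologicalSpace E]
  [IsTopologicalAddGroup E] [ContinuousSMul 𝕜 E]
variable {F : Type*} [AddCommGroup F] [Module 𝕜 F] [TopologicalSpace F]
  [IsTopologicalAddGroup F] [ContinuousSMul 𝕜 F]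

theorem tendsto_ofReal_coe_sub {T : Set ℝ} (t : T) :
    Tendsto (fun s : T => (((s : ℝ) - (t : ℝ) : ℝ) : 𝕜)) (𝓝[≠] t) (𝓝[≠] 0) := by
  refine (tendsto_ofReal_sub (t : ℝ)).comp (tendsto_nhdsWithin_iff.2 ⟨?_, ?_⟩)
  · exact (continuous_subtype_val.tendsto t).mono_left nhdsWithin_le_nhds
  · filter_upwards [self_mem_nhdsWithin] with s hs
    exact fun h => hs (Subtype.ext h)

theorem HasCurveDerivAt.congr {T : Set ℝ} {c c' : T → E} {v : E} {t : T}
    (h : HasCurveDerivAt 𝕜 c v t) (hc : c =ᶠ[𝓝 t] c') : HasCurveDerivAt 𝕜 c' v t := by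
  refine Tendsto.congr' ?_ h
  filter_upwards [hc.filter_mono nhdsWithin_le_nhds] with s hs
  rw [hs, hc.eq_of_nhds]

theorem HasCurveDerivAt.const {T : Set ℝ} (c : E) (t : T) :
    HasCurveDerivAt 𝕜 (fun _ : T => c) 0 t := by
  simp [HasCurveDerivAt, tendsto_const_nhds]

theorem HasCurveDerivAt.add {T : Set ℝ} {c c' : T → E} {v v' : E} {t : T}
    (h : HasCurveDerivAt 𝕜 c v t) (h' : HasCurveDerivAt 𝕜 c' v' t) :
    HasCurveDerivAt 𝕜 (fun s => c s + c' s) (v + v') t := by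
  refine (Tendsto.add h h').congr fun s => ?_
  rw [← smul_add, ← add_sub_add_comm]

theorem HasCurveDerivAt.neg {T : Set ℝ} {c : T → E} {v : E} {t : T}
    (h : HasCurveDerivAt 𝕜 c v t) : HasCurveDerivAt 𝕜 (fun s => -c s) (-v) t := by
  refine (Tendsto.neg h).congr fun s => ?_
  rw [← smul_neg, neg_sub, neg_sub_neg]

theorem HasCurveDerivAt.prodMk {T : Set ℝ} {c : T → E} {c' : T → F} {v : E} {v' : F} {t : T}
    (h : HasCurveDerivAt 𝕜 c v t) (h' : HasCurveDerivAt 𝕜 c' v' t) :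
    HasCurveDerivAt 𝕜 (fun s => (c s, c' s)) (v, v') t :=
  Tendsto.prodMk_nhds h h'

theorem hasCurveDerivAt_unique [T2Space E] {c : I → E} {v w : E} {t : I}
    (h : HasCurveDerivAt 𝕜 c v t) (h' : HasCurveDerivAt 𝕜 c w t) : v = w :=
  tendsto_nhds_unique h h'

variable {P : Type*} [TopologicalSpace P]

/-- The family `u (·, p)` of curves is `m` times differentiable on `J`, with derivatives which are
jointly continuous in the curve parameter and in `p`. -/
def IsParamC (𝕜 : Type*) [RCLike 𝕜] {E : Type*} [AddCommGroup E] [Module 𝕜 E] [TopologicalSpace E]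
    {P : Type*} [TopologicalSpace P] : ℕ → (I × P → E) → Set (I × P) → Prop
  | 0, u, J => ContinuousOn u J
  | m + 1, u, J => ContinuousOn u J ∧ ∃ u' : I × P → E,
      (∀ z ∈ J, HasCurveDerivAt 𝕜 (fun s : I => u (s, z.2)) (u' z) z.1) ∧ IsParamC 𝕜 m u' J

namespace IsParamC

variable {m : ℕ} {u v : I × P → E} {J J' : Set (I × P)}

theorem continuousOn (h : IsParamC 𝕜 m u J) : ContinuousOn u J := by
  cases m with
  | zero => exact h
  | succ m => exact h.1

theorem of_succ (h : IsParamC 𝕜 (m + 1) u J) : IsParamC 𝕜 m u J := by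
  induction m generalizing u with
  | zero => exact h.1
  | succ m ih =>
    obtain ⟨hc, u', hd, hu'⟩ := h
    exact ⟨hc, u', hd, ih hu'⟩

theorem mono (h : IsParamC 𝕜 m u J) (hJ : J' ⊆ J) : IsParamC 𝕜 m u J' := by
  induction m generalizing u with
  | zero => exact ContinuousOn.mono h hJ
  | succ m ih =>
    obtain ⟨hc, u', hd, hu'⟩ := h
    exact ⟨hc.mono hJ, u', fun z hz => hd z (hJ hz), ih hu'⟩

theorem _root_.LCLie.eventually_mem_slice (hJ : IsOpen J) {z : I × P} (hz : z ∈ J) :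
    ∀ᶠ s in 𝓝 z.1, (s, z.2) ∈ J :=
  (Continuous.prodMk_left (X := I) z.2).tendsto z.1 |>.eventually (hJ.mem_nhds hz)

theorem congr (hJ : IsOpen J) (h : IsParamC 𝕜 m u J) (huv : EqOn u v J) : IsParamC 𝕜 m v J := by
  cases m with
  | zero => exact ContinuousOn.congr h huv.symm
  | succ m =>
    obtain ⟨hc, u', hd, hu'⟩ := h
    refine ⟨hc.congr huv.symm, u', fun z hz => (hd z hz).congr ?_, hu'⟩
    filter_upwards [eventually_mem_slice hJ hz] with s hs
    exact huv hs

theorem const (c : E) : IsParamC 𝕜 m (fun _ : I × P => c) J := by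
  induction m generalizing c with
  | zero => exact continuousOn_const
  | succ m ih => exact ⟨continuousOn_const, _, fun z _ => HasCurveDerivAt.const c z.1, ih 0⟩

theorem add (hu : IsParamC 𝕜 m u J) (hv : IsParamC 𝕜 m v J) :
    IsParamC 𝕜 m (fun z => u z + v z) J := by
  induction m generalizing u v with
  | zero => exact ContinuousOn.add hu hv
  | succ m ih =>
    obtain ⟨hc, u', hd, hu'⟩ := hu
    obtain ⟨hc2, v', hd2, hv'⟩ := hv
    exact ⟨hc.add hc2, _, fun z hz => (hd z hz).add (hd2 z hz), ih hu' hv'⟩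

theorem neg (hu : IsParamC 𝕜 m u J) : IsParamC 𝕜 m (fun z => -u z) J := by
  induction m generalizing u with
  | zero => exact ContinuousOn.neg hu
  | succ m ih =>
    obtain ⟨hc, u', hd, hu'⟩ := hu
    exact ⟨hc.neg, _, fun z hz => (hd z hz).neg, ih hu'⟩

theorem sum {ι : Type*} (s : Finset ι) {w : ι → I × P → E} (hw : ∀ i, IsParamC 𝕜 m (w i) J) :
    IsParamC 𝕜 m (fun z => ∑ i ∈ s, w i z) J := by
  classical
  induction s using Finset.induction_on with
  | empty => simpa using const 0
  | insert i s hi ih => simpa [Finset.sum_insert hi] using (hw i).add ih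

theorem prodMk {w : I × P → F} (hu : IsParamC 𝕜 m u J) (hw : IsParamC 𝕜 m w J) :
    IsParamC 𝕜 m (fun z => (u z, w z)) J := by
  induction m generalizing u w with
  | zero => exact ContinuousOn.prodMk hu hw
  | succ m ih =>
    obtain ⟨hc, u', hd, hu'⟩ := hu
    obtain ⟨hc2, v', hd2, hv'⟩ := hw
    exact ⟨hc.prodMk hc2, _, fun z hz => (hd z hz).prodMk (hd2 z hz), ih hu' hv'⟩

/-- Being `C^m` is a local property. -/
theorem of_local [T2Space E] (h : ∀ z ∈ J, ∃ J', IsOpen J' ∧ z ∈ J' ∧ IsParamC 𝕜 m u J') :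
    IsParamC 𝕜 m u J := by
  induction m generalizing u with
  | zero =>
    intro z hz
    obtain ⟨J', hJ', hzJ, hu⟩ := h z hz
    exact (ContinuousOn.continuousAt hu (hJ'.mem_nhds hzJ)).continuousWithinAt
  | succ m ih =>
    refine ⟨fun z hz => ?_, ?_⟩
    · obtain ⟨J', hJ', hzJ, hu⟩ := h z hz
      exact (hu.1.continuousAt (hJ'.mem_nhds hzJ)).continuousWithinAt
    · classical
      -- Local derivatives are glued by uniqueness: one global candidate is fixed, equal to the
      -- derivative where it exists and to the irrelevant value `0` elsewhere.
      let u' : I × P → E := fun z =>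
        if hz : ∃ w, HasCurveDerivAt 𝕜 (fun s : I => u (s, z.2)) w z.1 then hz.choose else 0
      have hu' : ∀ z w, HasCurveDerivAt 𝕜 (fun s : I => u (s, z.2)) w z.1 → w = u' z :=
        fun z w hw => by
          have hz : ∃ w, HasCurveDerivAt 𝕜 (fun s : I => u (s, z.2)) w z.1 := ⟨w, hw⟩
          simp only [u', dif_pos hz]
          exact hasCurveDerivAt_unique hw hz.choose_spec
      refine ⟨u', fun z hz => ?_, ih fun z hz => ?_⟩
      · obtain ⟨J', hJ', hzJ, hc, v, hd, hv⟩ := h z hz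
        rw [← hu' z _ (hd z hzJ)]
        exact hd z hzJ
      · obtain ⟨J', hJ', hzJ, hc, v, hd, hv⟩ := h z hz
        exact ⟨J', hJ', hzJ, hv.congr hJ' fun x hx => hu' x _ (hd x hx)⟩

/-- Each `m` comes with its own derivative; uniqueness of limits makes them agree on `J`, so a
single `u'` serves all orders and the construction can be iterated. -/
theorem exists_deriv [T2Space E] (hJ : IsOpen J) (h : ∀ m, IsParamC 𝕜 m u J) :
    ∃ u' : I × P → E, (∀ z ∈ J, HasCurveDerivAt 𝕜 (fun s : I => u (s, z.2)) (u' z) z.1) ∧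
      ∀ m, IsParamC 𝕜 m u' J := by
  obtain ⟨_, u', hd, _⟩ := h 1
  refine ⟨u', hd, fun m => ?_⟩
  obtain ⟨_, v, hd2, hv⟩ := h (m + 1)
  exact hv.congr hJ fun z hz => hasCurveDerivAt_unique (hd2 z hz) (hd z hz)

theorem isSmoothCurveOn [T2Space E] (hJ : IsOpen J) (h : ∀ m, IsParamC 𝕜 m u J) (p : P) :
    IsSmoothCurveOn 𝕜 (fun t : I => u (t, p)) {t | (t, p) ∈ J} := by
  let step : {w : I × P → E // ∀ m, IsParamC 𝕜 m w J} → {w : I × P → E // ∀ m, IsParamC 𝕜 m w J} :=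
    fun w => ⟨(exists_deriv hJ w.2).choose, (exists_deriv hJ w.2).choose_spec.2⟩
  let D : ℕ → {w : I × P → E // ∀ m, IsParamC 𝕜 m w J} := fun k => step^[k] ⟨u, h⟩
  refine ⟨fun k t => (D k).1 (t, p), fun t _ => rfl, fun k => ⟨?_, fun t ht => ?_⟩⟩
  · exact ((D k).2 0).continuousOn.comp (Continuous.prodMk_left (X := I) p).continuousOn
      fun t ht => ht
  · have e : D (k + 1) = step (D k) := Function.iterate_succ_apply' _ _ _
    simp only [e]
    exact (exists_deriv hJ (D k).2).choose_spec.1 (t, p) ht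

theorem of_derivs {n : ℕ} {D : ℕ → I × P → E} (hc : ∀ k ≤ n, ContinuousOn (D k) J)
    (hd : ∀ k < n, ∀ z ∈ J, HasCurveDerivAt 𝕜 (fun s : I => D k (s, z.2)) (D (k + 1) z) z.1) :
    IsParamC 𝕜 n (D 0) J := by
  induction n generalizing D with
  | zero => exact hc 0 le_rfl
  | succ n ih =>
    exact ⟨hc 0 (Nat.zero_le _), D 1, hd 0 n.succ_pos, ih (D := fun k => D (k + 1))
      (fun k hk => hc _ (Nat.succ_le_succ hk)) fun k hk => hd _ (Nat.succ_lt_succ hk)⟩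

theorem exists_derivs {n : ℕ} (h : IsParamC 𝕜 n u J) : ∃ D : ℕ → I × P → E, D 0 = u ∧
    (∀ k ≤ n, ContinuousOn (D k) J) ∧
    ∀ k < n, ∀ z ∈ J, HasCurveDerivAt 𝕜 (fun s : I => D k (s, z.2)) (D (k + 1) z) z.1 := by
  induction n generalizing u with
  | zero =>
    refine ⟨fun _ => u, rfl, fun k _ => h, fun k hk => absurd hk (Nat.not_lt_zero _)⟩
  | succ n ih =>
    obtain ⟨hc, u', hd, hu'⟩ := h
    obtain ⟨D, rfl, hDc, hDd⟩ := ih hu'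
    refine ⟨fun k => Nat.casesOn k u D, rfl, fun k hk => ?_, fun k hk => ?_⟩
    · cases k with
      | zero => exact hc
      | succ k => exact hDc k (Nat.le_of_succ_le_succ hk)
    · cases k with
      | zero => exact hd
      | succ k => exact hDd k (Nat.lt_of_succ_lt_succ hk)

theorem of_isSmoothCurveOn {c : I → E} {K : Set I} (hK : IsOpen K) (h : IsSmoothCurveOn 𝕜 c K) :
    IsParamC 𝕜 m (fun z : I × P => c z.1) {z | z.1 ∈ K} := by
  obtain ⟨D, hD0, hD⟩ := h
  refine IsParamC.congr (hK.preimage continuous_fst) (of_derivs (D := fun k z => D k z.1)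
    (fun k _ => (hD k).1.comp continuousOn_fst fun z hz => hz)
    fun k _ z hz => (hD k).2 z.1 hz) fun z hz => hD0 hz

end IsParamC

namespace IsDerivFamily

variable {d : (k : ℕ) → E → (Fin k → E) → F} {f : E → F} {U : Set E}

/-- By `hasVelocity`, differentiating gives terms of the same shape: one with the differential of
order `k + 1`, the others with one direction replaced by its derivative. Induction on `m` therefore
has to run over all `k` and all directions simultaneously. -/
theorem isParamC [PolynormableSpace 𝕜 F] [T2Space F] (hd : IsDerivFamily 𝕜 d f U)
    (hU : IsOpen U) {J : Set (I × P)} {u : I × P → E} (huU : MapsTo u J U) (m : ℕ) :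
    ∀ (k : ℕ) (y : Fin k → I × P → E), IsParamC 𝕜 m u J → (∀ j, IsParamC 𝕜 m (y j) J) →
      IsParamC 𝕜 m (fun z => d k (u z) (fun j => y j z)) J := by
  have hcont : ∀ (k : ℕ) (y : Fin k → I × P → E), ContinuousOn u J → (∀ j, ContinuousOn (y j) J) →
      ContinuousOn (fun z => d k (u z) (fun j => y j z)) J := fun k y hu hy =>
    (hd.cont k).comp (hu.prodMk (continuousOn_pi.2 hy)) fun z hz => ⟨huU hz, mem_univ _⟩
  induction m with
  | zero => exact hcont
  | succ m ih =>
    intro k y hu hy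
    refine ⟨hcont k y hu.continuousOn fun j => (hy j).continuousOn, ?_⟩
    have hum := hu.of_succ
    have hym := fun j => (hy j).of_succ
    obtain ⟨_, u', hud, hu'⟩ := hu
    choose _ y' hyd hy' using hy
    refine ⟨fun z => d (k + 1) (u z) (fun i => (Fin.snoc y u' : Fin (k + 1) → I × P → E) i z)
      + ∑ j, d k (u z) (fun i => Function.update y j (y' j) i z), fun z hz => ?_, ?_⟩
    · have e1 : (fun i => (Fin.snoc y u' : Fin (k + 1) → I × P → E) i z)
          = Fin.snoc (fun i => y i z) (u' z) := by
        ext i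
        induction i using Fin.lastCases <;> simp
      have e2 : ∀ j, (fun i => Function.update y j (y' j) i z)
          = Function.update (fun i => y i z) j (y' j z) := fun j => by
        ext i
        by_cases hij : i = j
        · subst hij; simp
        · simp [hij]
      simp only [e1, e2]
      exact hd.hasVelocity hU (huU hz) (y := fun s i => y i (s, z.2))
        (tendsto_ofReal_coe_sub z.1) (hud z hz) fun j => hyd j z hz
    · refine (ih (k + 1) _ hum fun j => ?_).add (IsParamC.sum _ fun j => ih k _ hum fun i => ?_)
      · induction j using Fin.lastCases with
        | last => simpa using hu'
        | cast j => simpa using hym j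
      · by_cases hij : i = j
        · subst hij; simpa using hy' i
        · simpa [hij] using hym i

theorem isParamC_comp [PolynormableSpace 𝕜 F] [T2Space F] (hd : IsDerivFamily 𝕜 d f U)
    (hU : IsOpen U) {J : Set (I × P)} (hJ : IsOpen J) {u : I × P → E} (huU : MapsTo u J U) {m : ℕ}
    (hu : IsParamC 𝕜 m u J) : IsParamC 𝕜 m (fun z => f (u z)) J :=
  (hd.isParamC hU huU m 0 Fin.elim0 hu fun j => j.elim0).congr hJ fun _ hz => hd.zero _ (huU hz) _

end IsDerivFamily

/-! ### Derivatives of elements of `C^∞([0,1], E)` -/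

theorem SmoothCurve.iterDeriv_zero (γ : SmoothCurve 𝕜 E) (t : I) :
    SmoothCurve.iterDeriv 0 γ t = γ t :=
  γ.2.choose_spec.1 (mem_univ t)

theorem SmoothCurve.hasCurveDerivAt_iterDeriv (γ : SmoothCurve 𝕜 E) (k : ℕ) (t : I) :
    HasCurveDerivAt 𝕜 (SmoothCurve.iterDeriv k γ) (SmoothCurve.iterDeriv (k + 1) γ t) t :=
  (γ.2.choose_spec.2 k).2 t (mem_univ t)

/-- `iterDeriv` is extracted by choice from an existence statement; in a Hausdorff space every tower
of derivatives computes it. -/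
theorem SmoothCurve.iterDeriv_eq [T2Space E] {γ : SmoothCurve 𝕜 E} {n : ℕ} {D : ℕ → I → E}
    (h0 : ∀ t, D 0 t = γ t) (hD : ∀ k < n, ∀ t, HasCurveDerivAt 𝕜 (D k) (D (k + 1) t) t) :
    ∀ k ≤ n, ∀ t, SmoothCurve.iterDeriv k γ t = D k t := by
  intro k
  induction k with
  | zero => intro _ t; rw [SmoothCurve.iterDeriv_zero, h0]
  | succ k ih =>
    intro hk t
    refine hasCurveDerivAt_unique (γ.hasCurveDerivAt_iterDeriv k t) ((hD k hk t).congr ?_)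
    exact Eventually.of_forall fun s => (ih (Nat.le_of_succ_le hk) s).symm

theorem continuous_iterDeriv {n : ℕ∞} {k : ℕ} (hk : (k : ℕ∞) ≤ n) :
    Continuous[curveTopology 𝕜 E n, ContinuousMap.compactOpen]
      (SmoothCurve.iterDeriv (𝕜 := 𝕜) (E := E) k) := by
  rw [continuous_iff_le_induced]
  exact iInf₂_le k hk

/-- A family of smooth curves which depends continuously on its parameter with respect to the
`C^n`-topology is a `C^n`-family. -/
theorem SmoothCurve.isParamC {n : ℕ} {c : P → SmoothCurve 𝕜 E}
    (hc : ∀ k ≤ n, Continuous fun p => SmoothCurve.iterDeriv k (c p)) :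
    IsParamC 𝕜 n (fun z : I × P => c z.2 z.1) univ := by
  have h := IsParamC.of_derivs (𝕜 := 𝕜) (n := n) (J := (univ : Set (I × P)))
    (D := fun k z => SmoothCurve.iterDeriv k (c z.2) z.1) (fun k hk => ?_)
    fun k _ z _ => SmoothCurve.hasCurveDerivAt_iterDeriv (c z.2) k z.1
  · exact h.congr isOpen_univ fun z _ => SmoothCurve.iterDeriv_zero _ _
  · exact (((hc k hk).comp continuous_snd).eval continuous_fst).continuousOn

/-- Conversely, `C^n`-families depend continuously on the parameter in the `C^n`-topology. -/
theorem SmoothCurve.continuous_of_isParamC [T2Space E] {n : ℕ} {c : P → SmoothCurve 𝕜 E}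
    (h : IsParamC 𝕜 n (fun z : I × P => c z.2 z.1) univ) :
    Continuous[_, curveTopology 𝕜 E n] c := by
  obtain ⟨D, hD0, hDc, hDd⟩ := h.exists_derivs
  refine continuous_iInf_rng.2 fun k => continuous_iInf_rng.2 fun hk => continuous_induced_rng.2 ?_
  have hk' : k ≤ n := by exact_mod_cast hk
  -- Joint continuity in parameter and time gives continuity into `C(I, E)` with the compact-open
  -- topology.
  refine ContinuousMap.continuous_of_continuous_uncurry _ ?_
  have e : ∀ p t, SmoothCurve.iterDeriv k (c p) t = D k (t, p) := fun p t =>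
    SmoothCurve.iterDeriv_eq (D := fun k t => D k (t, p)) (fun t => by rw [hD0])
      (fun k hk t => hDd k hk (t, p) (mem_univ _)) k hk' t
  have h2 := (continuousOn_univ.1 (hDc k hk')).comp (continuous_swap (X := P) (Y := I))
  refine h2.congr fun z => ?_
  exact (e z.1 z.2).symm

end ParamCurve

/-! ### Velocities of curves in Lie groups -/

section Velocity

variable {𝕜 : Type*} [RCLike 𝕜]
variable {E : Type*} [AddCommGroup E] [Module 𝕜 E] [TopologicalSpace E]
  [IsTopologicalAddGroup E] [ContinuousSMul 𝕜 E]
variable {G : Type*} [TopologicalSpace G] [ChartedSpace E G] [Group G]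
variable {ι ι' : Type*} {l : Filter ι} {h : ι → 𝕜} {l' : Filter ι'} {h' : ι' → 𝕜}

/-- Along the filter `l`, the curve `α` passes through `g` with velocity `w` in the chart `e`,
where `h` is the time parameter. -/
structure HasVel (e : OpenPartialHomeomorph G E) (l : Filter ι) (h : ι → 𝕜) (α : ι → G) (g : G)
    (w : E) : Prop where
  mem_source : g ∈ e.source
  tendsto : Tendsto α l (𝓝 g)
  slope : Tendsto (fun s => (h s)⁻¹ • (e (α s) - e g)) l (𝓝 w)

theorem HasVel.unique [T2Space E] [l.NeBot] {e : OpenPartialHomeomorph G E} {α : ι → G} {g : G}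
    {w w' : E} (hw : HasVel e l h α g w) (hw' : HasVel e l h α g w') : w = w' :=
  tendsto_nhds_unique hw.slope hw'.slope

theorem HasVel.const {e : OpenPartialHomeomorph G E} {g : G} (hg : g ∈ e.source) :
    HasVel e l h (fun _ => g) g 0 :=
  ⟨hg, tendsto_const_nhds, by simp [tendsto_const_nhds]⟩

/-- The curve through `1` which is affine in the preferred chart. -/
def chartLine (G : Type*) [TopologicalSpace G] [ChartedSpace E G] [Group G] (v : E) (r : 𝕜) : G :=
  (chartAt E (1 : G)).symm (chartAt E (1 : G) 1 + r • v)

theorem hasVel_chartLine (v : E) :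
    HasVel (chartAt E (1 : G)) (𝓝[≠] (0 : 𝕜)) id (chartLine G v) 1 v := by
  have hs : (1 : G) ∈ (chartAt E (1 : G)).source := mem_chart_source E 1
  have ht := (chartAt E (1 : G)).map_source hs
  have h1 := tendsto_add_smul (𝕜 := 𝕜) (chartAt E (1 : G) 1) v
  refine ⟨hs, ?_, ?_⟩
  · have h2 := ((chartAt E (1 : G)).continuousAt_symm ht).tendsto.comp h1
    rwa [(chartAt E (1 : G)).left_inv hs] at h2
  · refine Tendsto.congr' ?_ (tendsto_const_nhds (x := v))
    filter_upwards [h1.eventually ((chartAt E (1 : G)).open_target.mem_nhds ht),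
      self_mem_nhdsWithin] with r hr hr0
    rw [chartLine, (chartAt E (1 : G)).right_inv hr, add_sub_cancel_left, id, smul_smul,
      inv_mul_cancel₀ hr0, one_smul]

theorem hasVel_of_hasCurveDerivAt {e : OpenPartialHomeomorph G E} {η : I → G} {t : I} {w : E}
    (hη : Continuous η) (ht : η t ∈ e.source) (hw : HasCurveDerivAt 𝕜 (fun s => e (η s)) w t) :
    HasVel e (𝓝[≠] t) (fun s : I => (((s : ℝ) - (t : ℝ) : ℝ) : 𝕜)) η (η t) w :=
  ⟨ht, (hη.tendsto t).mono_left nhdsWithin_le_nhds, hw⟩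

variable (hG : IsLieGroup 𝕜 E G)
include hG

theorem isLeftTranslate_iff {g : G} {v w : E} : IsLeftTranslate 𝕜 E g v w ↔
    HasVel (chartAt E g) (𝓝[≠] (0 : 𝕜)) id (fun r => g * chartLine G v r) g w := by
  have e1 : (chartAt E (1 : G)).symm (chartAt E (1 : G) 1) = 1 :=
    (chartAt E (1 : G)).left_inv (mem_chart_source E 1)
  constructor
  · intro hw
    refine ⟨mem_chart_source E g, ?_, ?_⟩
    · have h1 := (hasVel_chartLine (𝕜 := 𝕜) (G := G) v).tendsto
      have h2 := (hG.continuous_mul.tendsto (g, (1 : G))).comp (tendsto_const_nhds.prodMk_nhds h1)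
      simpa [Function.comp_def] using h2
    · refine hw.congr fun r => ?_
      simp only [e1, mul_one, id]
      rfl
  · intro hw
    refine hw.slope.congr fun r => ?_
    simp only [e1, mul_one, id]
    rfl

theorem isOpen_mul_domain (e₁ e₂ e₃ : OpenPartialHomeomorph G E) :
    IsOpen {p : E × E | p.1 ∈ e₁.target ∧ p.2 ∈ e₂.target ∧
      e₁.symm p.1 * e₂.symm p.2 ∈ e₃.source} := by
  have hc : ContinuousOn (fun p : E × E => e₁.symm p.1 * e₂.symm p.2) (e₁.target ×ˢ e₂.target) :=
    hG.continuous_mul.comp_continuousOn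
      ((e₁.continuousOn_symm.comp continuousOn_fst fun p hp => hp.1).prodMk
        (e₂.continuousOn_symm.comp continuousOn_snd fun p hp => hp.2))
  convert hc.isOpen_inter_preimage (e₁.open_target.prod e₂.open_target) e₃.open_source using 1
  ext p
  simp [and_assoc]

theorem isOpen_inv_domain (e₁ e₂ : OpenPartialHomeomorph G E) :
    IsOpen {x : E | x ∈ e₁.target ∧ (e₁.symm x)⁻¹ ∈ e₂.source} :=
  (hG.continuous_inv.comp_continuousOn e₁.continuousOn_symm).isOpen_inter_preimage e₁.open_target
    e₂.open_source

variable {e₁ e₂ e₃ : OpenPartialHomeomorph G E}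

/-- The chain rule for multiplication in charts. As filter and time parameter are arbitrary, it
covers curves on `[0,1]`, where `s → t`, as well as the curves `chartLine`, where `r → 0` in `𝕜`;
this permits trading one kind for the other when only velocities matter. -/
theorem hasVel_mul {d : (k : ℕ) → E × E → (Fin k → E × E) → E}
    (hd : IsDerivFamily 𝕜 d (fun p : E × E => e₃ (e₁.symm p.1 * e₂.symm p.2))
      {p | p.1 ∈ e₁.target ∧ p.2 ∈ e₂.target ∧ e₁.symm p.1 * e₂.symm p.2 ∈ e₃.source})
    (hh : Tendsto h l (𝓝[≠] 0)) {α κ : ι → G} {g k : G} {a b : E}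
    (hα : HasVel e₁ l h α g a) (hκ : HasVel e₂ l h κ k b) (hgk : g * k ∈ e₃.source) :
    HasVel e₃ l h (fun s => α s * κ s) (g * k) (d 1 (e₁ g, e₂ k) fun _ => (a, b)) := by
  have _ := hG.model_locallyConvex
  have ht : Tendsto (fun s => α s * κ s) l (𝓝 (g * k)) :=
    (hG.continuous_mul.tendsto (g, k)).comp (hα.tendsto.prodMk_nhds hκ.tendsto)
  refine ⟨hgk, ht, ?_⟩
  have hmem : (e₁ g, e₂ k) ∈ {p : E × E | p.1 ∈ e₁.target ∧ p.2 ∈ e₂.target ∧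
      e₁.symm p.1 * e₂.symm p.2 ∈ e₃.source} :=
    ⟨e₁.map_source hα.mem_source, e₂.map_source hκ.mem_source, by
      simpa [e₁.left_inv hα.mem_source, e₂.left_inv hκ.mem_source] using hgk⟩
  have h1 := hd.hasVelocity_comp (isOpen_mul_domain hG e₁ e₂ e₃) hmem hh
    (u := fun s => (e₁ (α s), e₂ (κ s))) (w := (a, b)) (hα.slope.prodMk_nhds hκ.slope)
  refine h1.congr' ?_
  filter_upwards [hα.tendsto.eventually (e₁.open_source.mem_nhds hα.mem_source),
    hκ.tendsto.eventually (e₂.open_source.mem_nhds hκ.mem_source)] with s h2 h3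
  simp only [e₁.left_inv h2, e₂.left_inv h3, e₁.left_inv hα.mem_source,
    e₂.left_inv hκ.mem_source]

theorem hasVel_inv {d : (k : ℕ) → E → (Fin k → E) → E}
    (hd : IsDerivFamily 𝕜 d (fun x => e₂ (e₁.symm x)⁻¹)
      {x | x ∈ e₁.target ∧ (e₁.symm x)⁻¹ ∈ e₂.source})
    (hh : Tendsto h l (𝓝[≠] 0)) {α : ι → G} {g : G} {a : E}
    (hα : HasVel e₁ l h α g a) (hg : g⁻¹ ∈ e₂.source) :
    HasVel e₂ l h (fun s => (α s)⁻¹) g⁻¹ (d 1 (e₁ g) fun _ => a) := by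
  have _ := hG.model_locallyConvex
  refine ⟨hg, (hG.continuous_inv.tendsto g).comp hα.tendsto, ?_⟩
  have hmem : e₁ g ∈ {x : E | x ∈ e₁.target ∧ (e₁.symm x)⁻¹ ∈ e₂.source} :=
    ⟨e₁.map_source hα.mem_source, by simpa [e₁.left_inv hα.mem_source] using hg⟩
  have h1 := hd.hasVelocity_comp (isOpen_inv_domain hG e₁ e₂) hmem hh hα.slope
  refine h1.congr' ?_
  filter_upwards [hα.tendsto.eventually (e₁.open_source.mem_nhds hα.mem_source)] with s h2
  simp only [e₁.left_inv h2, e₁.left_inv hα.mem_source]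

/-- The velocity of a product depends only on the velocities of the factors. -/
theorem exists_hasVel_mul (he₁ : e₁ ∈ atlas E G) (he₂ : e₂ ∈ atlas E G) (he₃ : e₃ ∈ atlas E G)
    (hh : Tendsto h l (𝓝[≠] 0)) (hh' : Tendsto h' l' (𝓝[≠] 0)) {α κ : ι → G} {α' κ' : ι' → G}
    {g k : G} {a b : E} (hα : HasVel e₁ l h α g a) (hκ : HasVel e₂ l h κ k b)
    (hα' : HasVel e₁ l' h' α' g a) (hκ' : HasVel e₂ l' h' κ' k b) (hgk : g * k ∈ e₃.source) :
    ∃ w, HasVel e₃ l h (fun s => α s * κ s) (g * k) w ∧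
      HasVel e₃ l' h' (fun s => α' s * κ' s) (g * k) w := by
  obtain ⟨d, hd⟩ := isSmoothOn_iff.1 (hG.smooth_mul e₁ he₁ e₂ he₂ e₃ he₃)
  exact ⟨_, hasVel_mul hG hd hh hα hκ hgk, hasVel_mul hG hd hh' hα' hκ' hgk⟩

theorem exists_hasVel_inv (he₁ : e₁ ∈ atlas E G) (he₂ : e₂ ∈ atlas E G)
    (hh : Tendsto h l (𝓝[≠] 0)) (hh' : Tendsto h' l' (𝓝[≠] 0)) {α : ι → G} {α' : ι' → G}
    {g : G} {a : E} (hα : HasVel e₁ l h α g a) (hα' : HasVel e₁ l' h' α' g a)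
    (hg : g⁻¹ ∈ e₂.source) :
    ∃ w, HasVel e₂ l h (fun s => (α s)⁻¹) g⁻¹ w ∧ HasVel e₂ l' h' (fun s => (α' s)⁻¹) g⁻¹ w := by
  obtain ⟨d, hd⟩ := isSmoothOn_iff.1 (hG.smooth_inv e₁ he₁ e₂ he₂)
  exact ⟨_, hasVel_inv hG hd hh hα hg, hasVel_inv hG hd hh' hα' hg⟩

/-! ### Curves with vanishing velocity, and uniqueness of product integrals. -/

omit hG [Group G] in
theorem eq_of_hasCurveDerivAt_zero [PolynormableSpace 𝕜 E] [T2Space E] {c : I → E} {a b : I}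
    (hab : a ≤ b) (hc : ∀ t ∈ Icc a b, HasCurveDerivAt 𝕜 c 0 t) : c a = c b := by
  by_contra hne
  obtain ⟨⟨p, hp⟩, hpne⟩ := (PolynormableSpace.withSeminorms 𝕜 E).separating_of_T1 (c b - c a)
    (sub_ne_zero.2 (Ne.symm hne))
  have hab' : (a : ℝ) ≤ b := hab
  -- The mean value inequality is stated for functions on `ℝ`, so the curve is extended by
  -- projection onto `[0,1]`; only points of `[a, b]` enter.
  have key := seminorm_sub_le (𝕜 := 𝕜) p hp (φ := fun z => c (projIcc 0 1 zero_le_one z))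
    (φ' := fun _ => 0) (C := 0) hab' (fun x hx => ?_) (fun x _ => (map_zero p).le)
  · simp only [projIcc_val, zero_mul] at key
    exact hpne (le_antisymm key (apply_nonneg p _))
  · have hI : ∀ z ∈ Icc (a : ℝ) b, z ∈ Icc (0 : ℝ) 1 := fun z hz =>
      ⟨a.2.1.trans hz.1, hz.2.trans b.2.2⟩
    have hpx : projIcc 0 1 zero_le_one x = ⟨x, hI x hx⟩ := projIcc_of_mem _ (hI x hx)
    have ht : Tendsto (projIcc (0 : ℝ) 1 zero_le_one) (𝓝[Icc (a : ℝ) b \ {x}] x)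
        (𝓝[≠] (⟨x, hI x hx⟩ : I)) := by
      refine tendsto_nhdsWithin_iff.2 ⟨?_, ?_⟩
      · have := (continuous_projIcc (a := (0 : ℝ)) (b := 1) (h := zero_le_one)).tendsto x
        rw [hpx] at this
        exact this.mono_left nhdsWithin_le_nhds
      · filter_upwards [self_mem_nhdsWithin] with z hz
        rw [projIcc_of_mem _ (hI z hz.1)]
        exact fun h => hz.2 (Subtype.ext_iff.1 h)
    refine ((hc ⟨x, hI x hx⟩ hx).comp ht).congr' ?_
    filter_upwards [self_mem_nhdsWithin] with z hz
    simp only [Function.comp_apply, hpx, projIcc_of_mem _ (hI z hz.1)]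

theorem eq_of_velocity_zero {c : I → G} (hcont : Continuous c)
    (hc : ∀ t, ∀ e ∈ atlas E G, c t ∈ e.source → HasCurveDerivAt 𝕜 (fun s => e (c s)) 0 t)
    (s t : I) : c s = c t := by
  have _ := hG.model_locallyConvex
  have _ := hG.model_t2
  -- Within one chart the curve is constant by the vector-valued case; connectedness of `[0,1]`
  -- makes this global.
  refine IsLocallyConstant.apply_eq_of_preconnectedSpace
    ((IsLocallyConstant.iff_eventually_eq _).2 fun t₀ => ?_) s t
  set e := chartAt E (c t₀)
  have hmem : c ⁻¹' e.source ∈ 𝓝 t₀ :=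
    hcont.tendsto t₀ (e.open_source.mem_nhds (mem_chart_source E (c t₀)))
  obtain ⟨ε, hε, hball⟩ := Metric.mem_nhds_iff.1 hmem
  filter_upwards [Metric.ball_mem_nhds t₀ hε] with s hs
  have hs' : |(s : ℝ) - t₀| < ε := by simpa [Subtype.dist_eq, Real.dist_eq] using hs
  have hsub : ∀ r : I, (|(r : ℝ) - t₀| < ε) → c r ∈ e.source := fun r hr =>
    hball (by simpa [Subtype.dist_eq, Real.dist_eq] using hr)
  refine e.injOn (hsub s hs') (mem_chart_source E (c t₀)) ?_
  rw [abs_lt] at hs'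
  rcases le_total s t₀ with hle | hle
  · refine eq_of_hasCurveDerivAt_zero (𝕜 := 𝕜) (c := fun r => e (c r)) hle fun r hr =>
      hc r e (chart_mem_atlas E _) (hsub r ?_)
    have h1 : (s : ℝ) ≤ r := hr.1
    have h2 : (r : ℝ) ≤ t₀ := hr.2
    rw [abs_lt]
    constructor <;> linarith
  · refine (eq_of_hasCurveDerivAt_zero (𝕜 := 𝕜) (c := fun r => e (c r)) hle fun r hr =>
      hc r e (chart_mem_atlas E _) (hsub r ?_)).symm
    have h1 : (t₀ : ℝ) ≤ r := hr.1
    have h2 : (r : ℝ) ≤ s := hr.2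
    rw [abs_lt]
    constructor <;> linarith

/-- The curve `η ξ⁻¹` has velocity zero. At time `t`, both `η` and `ξ` have the velocities of `g ·
line` and `k · line` for one and the same line, and `(g · line)(k · line)⁻¹ = g k⁻¹` is constant. -/
theorem IsProductIntegral.unique {γ : SmoothCurve 𝕜 E} {η ξ : I → G}
    (hη : IsProductIntegral 𝕜 γ η) (hξ : IsProductIntegral 𝕜 γ ξ) : η = ξ := by
  have _ := hG.model_t2
  have hc : Continuous fun t => η t * (ξ t)⁻¹ :=
    hG.continuous_mul.comp (hη.1.1.prodMk (hG.continuous_inv.comp hξ.1.1))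
  have key := eq_of_velocity_zero hG hc fun t e he ht => ?_
  · ext t
    have := key t 0
    rw [hη.2.1, hξ.2.1, inv_one, mul_one] at this
    exact mul_inv_eq_one.1 this
  obtain ⟨w₁, hw₁, hl₁⟩ := hη.2.2 t
  obtain ⟨w₂, hw₂, hl₂⟩ := hξ.2.2 t
  have hI := tendsto_ofReal_coe_sub (𝕜 := 𝕜) t
  have h0 : Tendsto (id : 𝕜 → 𝕜) (𝓝[≠] 0) (𝓝[≠] 0) := tendsto_id
  have hv₁ := hasVel_of_hasCurveDerivAt hη.1.1 (mem_chart_source E _) hw₁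
  have hv₂ := hasVel_of_hasCurveDerivAt hξ.1.1 (mem_chart_source E _) hw₂
  obtain ⟨w₃, hw₃, hw₃'⟩ := exists_hasVel_inv hG (chart_mem_atlas E (ξ t))
    (chart_mem_atlas E (ξ t)⁻¹) hI h0 hv₂ ((isLeftTranslate_iff hG).1 hl₂) (mem_chart_source E _)
  obtain ⟨w, hw, hw'⟩ := exists_hasVel_mul hG (chart_mem_atlas E (η t))
    (chart_mem_atlas E (ξ t)⁻¹) he hI h0 hv₁ hw₃ ((isLeftTranslate_iff hG).1 hl₁) hw₃' ht
  have e0 : w = 0 := by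
    refine hw'.unique ?_
    simp only [mul_inv_rev, mul_assoc, mul_inv_cancel_left]
    exact HasVel.const ht
  rw [← e0]
  exact hw.slope

theorem IsProductIntegral.evol_eq {γ : SmoothCurve 𝕜 E} {η : I → G}
    (hη : IsProductIntegral 𝕜 γ η) : evol 𝕜 E G γ = η 1 := by
  have hex : ∃ η : I → G, IsProductIntegral 𝕜 γ η := ⟨η, hη⟩
  rw [evol, dif_pos hex, hex.choose_spec.unique hG hη]

end Velocity

/-! ### Continuity of the evolution map from continuity at zero -/

section Evolution

variable {𝕜 : Type*} [RCLike 𝕜]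
variable {E : Type*} [AddCommGroup E] [Module 𝕜 E] [TopologicalSpace E]
  [IsTopologicalAddGroup E] [ContinuousSMul 𝕜 E]
variable {G : Type*} [TopologicalSpace G] [ChartedSpace E G] [Group G]
variable {P : Type*} [TopologicalSpace P]
variable (hG : IsLieGroup 𝕜 E G)
include hG

theorem isParamC_mul {e₁ e₂ e₃ : OpenPartialHomeomorph G E} (he₁ : e₁ ∈ atlas E G)
    (he₂ : e₂ ∈ atlas E G) (he₃ : e₃ ∈ atlas E G) {m : ℕ} {J : Set (I × P)} (hJ : IsOpen J)
    {α κ : I × P → G} (hα : IsParamC 𝕜 m (fun z => e₁ (α z)) J)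
    (hκ : IsParamC 𝕜 m (fun z => e₂ (κ z)) J) (h₁ : MapsTo α J e₁.source)
    (h₂ : MapsTo κ J e₂.source) (h₃ : MapsTo (fun z => α z * κ z) J e₃.source) :
    IsParamC 𝕜 m (fun z => e₃ (α z * κ z)) J := by
  have _ := hG.model_locallyConvex
  have _ := hG.model_t2
  obtain ⟨d, hd⟩ := isSmoothOn_iff.1 (hG.smooth_mul e₁ he₁ e₂ he₂ e₃ he₃)
  refine (hd.isParamC_comp (isOpen_mul_domain hG e₁ e₂ e₃) hJ (fun z hz => ?_)
    (hα.prodMk hκ)).congr hJ fun z hz => ?_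
  · refine ⟨e₁.map_source (h₁ hz), e₂.map_source (h₂ hz), ?_⟩
    simpa only [e₁.left_inv (h₁ hz), e₂.left_inv (h₂ hz)] using h₃ hz
  · simp only [e₁.left_inv (h₁ hz), e₂.left_inv (h₂ hz)]

theorem isParamC_inv {e₁ e₂ : OpenPartialHomeomorph G E} (he₁ : e₁ ∈ atlas E G)
    (he₂ : e₂ ∈ atlas E G) {m : ℕ} {J : Set (I × P)} (hJ : IsOpen J)
    {α : I × P → G} (hα : IsParamC 𝕜 m (fun z => e₁ (α z)) J)
    (h₁ : MapsTo α J e₁.source) (h₂ : MapsTo (fun z => (α z)⁻¹) J e₂.source) :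
    IsParamC 𝕜 m (fun z => e₂ (α z)⁻¹) J := by
  have _ := hG.model_locallyConvex
  have _ := hG.model_t2
  obtain ⟨d, hd⟩ := isSmoothOn_iff.1 (hG.smooth_inv e₁ he₁ e₂ he₂)
  refine (hd.isParamC_comp (isOpen_inv_domain hG e₁ e₂) hJ (fun z hz => ?_) hα).congr hJ
    fun z hz => ?_
  · refine ⟨e₁.map_source (h₁ hz), ?_⟩
    simpa only [e₁.left_inv (h₁ hz)] using h₂ hz
  · simp only [e₁.left_inv (h₁ hz)]

omit hG [Group G] in
theorem IsSmoothCurve.isParamC {η : I → G} (hη : IsSmoothCurve 𝕜 E η)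
    {e : OpenPartialHomeomorph G E} (he : e ∈ atlas E G) (m : ℕ) :
    IsParamC 𝕜 m (fun z : I × P => e (η z.1)) {z | η z.1 ∈ e.source} :=
  IsParamC.of_isSmoothCurveOn (e.open_source.preimage hη.1) (hη.2 e he)

/-- Charts for the factors are only available locally in time, hence the passage through
`IsParamC.of_local`; the parameter space `Unit` specialises families to single curves. -/
theorem IsSmoothCurve.mul {α κ : I → G} (hα : IsSmoothCurve 𝕜 E α) (hκ : IsSmoothCurve 𝕜 E κ) :
    IsSmoothCurve 𝕜 E fun t => α t * κ t := by
  have _ := hG.model_t2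
  have hc : Continuous fun t => α t * κ t := hG.continuous_mul.comp (hα.1.prodMk hκ.1)
  refine ⟨hc, fun e he => ?_⟩
  have hJ : IsOpen {z : I × Unit | α z.1 * κ z.1 ∈ e.source} :=
    e.open_source.preimage (hc.comp continuous_fst)
  refine IsParamC.isSmoothCurveOn (u := fun z : I × Unit => e (α z.1 * κ z.1)) hJ
    (fun m => IsParamC.of_local fun z hz => ?_) ()
  have hJ' : IsOpen {x : I × Unit | (α x.1 ∈ (chartAt E (α z.1)).source ∧
      κ x.1 ∈ (chartAt E (κ z.1)).source) ∧ α x.1 * κ x.1 ∈ e.source} :=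
    (((chartAt E (α z.1)).open_source.preimage (hα.1.comp continuous_fst)).inter
      ((chartAt E (κ z.1)).open_source.preimage (hκ.1.comp continuous_fst))).inter hJ
  refine ⟨_, hJ', ⟨⟨mem_chart_source E _, mem_chart_source E _⟩, hz⟩, ?_⟩
  exact isParamC_mul hG (chart_mem_atlas E _) (chart_mem_atlas E _) he hJ'
    (α := fun x => α x.1) (κ := fun x => κ x.1)
    ((hα.isParamC (chart_mem_atlas E _) m).mono fun x hx => hx.1.1)
    ((hκ.isParamC (chart_mem_atlas E _) m).mono fun x hx => hx.1.2)
    (fun x hx => hx.1.1) (fun x hx => hx.1.2) fun x hx => hx.2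

/-! ### The adjoint action and products of product integrals. -/

omit hG in
open Classical in
/-- The adjoint action of `g` on the Lie algebra (with value `0` if the velocity of the conjugated
curve does not exist). -/
def adjoint (𝕜 : Type*) [RCLike 𝕜] {E : Type*} [AddCommGroup E] [Module 𝕜 E] [TopologicalSpace E]
    {G : Type*} [TopologicalSpace G] [ChartedSpace E G] [Group G] (g : G) (v : E) : E :=
  if h : ∃ w : E, HasVel (chartAt E (1 : G)) (𝓝[≠] (0 : 𝕜)) id
    (fun r => g * chartLine G v r * g⁻¹) 1 w then h.choose else 0

/-- Conjugation is two multiplications, by `g` on the left and then by the constant `g⁻¹` on the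
right. The charts `e` and `e'` are not tied to `g`, so one formula describes `Ad` for all `g` near a
given point; `isParamC_adjoint` differentiates it. -/
theorem hasVel_conj {e e' : OpenPartialHomeomorph G E} {d d' : (k : ℕ) → E × E → (Fin k → E × E) → E}
    (hd : IsDerivFamily 𝕜 d (fun p : E × E => e (e.symm p.1 * (chartAt E (1 : G)).symm p.2))
      {p | p.1 ∈ e.target ∧ p.2 ∈ (chartAt E (1 : G)).target ∧
        e.symm p.1 * (chartAt E (1 : G)).symm p.2 ∈ e.source})
    (hd' : IsDerivFamily 𝕜 d' (fun p : E × E => chartAt E (1 : G) (e.symm p.1 * e'.symm p.2))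
      {p | p.1 ∈ e.target ∧ p.2 ∈ e'.target ∧
        e.symm p.1 * e'.symm p.2 ∈ (chartAt E (1 : G)).source})
    {g : G} (hg : g ∈ e.source) (hg' : g⁻¹ ∈ e'.source) (v : E) :
    HasVel (chartAt E (1 : G)) (𝓝[≠] (0 : 𝕜)) id (fun r => g * chartLine G v r * g⁻¹) 1
      (d' 1 (e g, e' g⁻¹) fun _ => (d 1 (e g, chartAt E (1 : G) 1) (fun _ => (0, v)), 0)) := by
  have h1 := hasVel_mul hG hd tendsto_id (HasVel.const hg) (hasVel_chartLine v) (by simpa using hg)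
  rw [mul_one] at h1
  have h2 := hasVel_mul hG hd' tendsto_id h1 (HasVel.const hg')
    (by simp [mem_chart_source E (1 : G)])
  rwa [mul_inv_cancel] at h2

theorem hasVel_adjoint (g : G) (v : E) :
    HasVel (chartAt E (1 : G)) (𝓝[≠] (0 : 𝕜)) id (fun r => g * chartLine G v r * g⁻¹) 1
      (adjoint 𝕜 g v) := by
  obtain ⟨d, hd⟩ := isSmoothOn_iff.1 (hG.smooth_mul _ (chart_mem_atlas E g) _
    (chart_mem_atlas E 1) _ (chart_mem_atlas E g))
  obtain ⟨d', hd'⟩ := isSmoothOn_iff.1 (hG.smooth_mul _ (chart_mem_atlas E g) _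
    (chart_mem_atlas E g⁻¹) _ (chart_mem_atlas E 1))
  have hex : ∃ w : E, HasVel (chartAt E (1 : G)) (𝓝[≠] (0 : 𝕜)) id
      (fun r => g * chartLine G v r * g⁻¹) 1 w :=
    ⟨_, hasVel_conj hG hd hd' (mem_chart_source E g) (mem_chart_source E g⁻¹) v⟩
  rw [adjoint, dif_pos hex]
  exact hex.choose_spec

theorem adjoint_zero (g : G) : adjoint 𝕜 g (0 : E) = 0 := by
  have _ := hG.model_t2
  have h1 := hasVel_adjoint hG (𝕜 := 𝕜) g (0 : E)
  have e0 : ∀ r : 𝕜, chartLine G (0 : E) r = 1 := fun r => by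
    rw [chartLine, smul_zero, add_zero]
    exact (chartAt E (1 : G)).left_inv (mem_chart_source E 1)
  simp only [e0, mul_one, mul_inv_cancel] at h1
  exact h1.unique (HasVel.const (mem_chart_source E 1))

/-- The adjoint action along a smooth curve preserves the regularity of families of curves. -/
theorem isParamC_adjoint {η : I → G} (hη : IsSmoothCurve 𝕜 E η) {m : ℕ} {u : I × P → E}
    (hu : IsParamC 𝕜 m u univ) : IsParamC 𝕜 m (fun z => adjoint 𝕜 (η z.1) (u z)) univ := by
  have _ := hG.model_locallyConvex
  have _ := hG.model_t2
  refine IsParamC.of_local fun z _ => ?_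
  set e := chartAt E (η z.1)
  set e' := chartAt E (η z.1)⁻¹
  set φ := chartAt E (1 : G)
  obtain ⟨d, hd⟩ := isSmoothOn_iff.1 (hG.smooth_mul e (chart_mem_atlas E _) φ
    (chart_mem_atlas E 1) e (chart_mem_atlas E _))
  obtain ⟨d', hd'⟩ := isSmoothOn_iff.1 (hG.smooth_mul e (chart_mem_atlas E _) e'
    (chart_mem_atlas E _) φ (chart_mem_atlas E 1))
  set J : Set (I × P) := {x | η x.1 ∈ e.source ∧ (η x.1)⁻¹ ∈ e'.source}
  have hJ : IsOpen J := (e.open_source.preimage (hη.1.comp continuous_fst)).inter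
    (e'.open_source.preimage (hG.continuous_inv.comp (hη.1.comp continuous_fst)))
  refine ⟨J, hJ, ⟨mem_chart_source E _, mem_chart_source E _⟩, ?_⟩
  have h1 : IsParamC 𝕜 m (fun x : I × P => e (η x.1)) J :=
    (hη.isParamC (chart_mem_atlas E _) m).mono fun x hx => hx.1
  have h2 : IsParamC 𝕜 m (fun x : I × P => e' (η x.1)⁻¹) J :=
    isParamC_inv hG (chart_mem_atlas E _) (chart_mem_atlas E _) hJ (α := fun x => η x.1) h1
      (fun x hx => hx.1) fun x hx => hx.2
  have h3 := hd.isParamC (isOpen_mul_domain hG e φ e) (J := J)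
    (u := fun x => (e (η x.1), φ 1)) (fun x hx => ?_) m 1 (fun _ x => (0, u x))
    (h1.prodMk (IsParamC.const _))
    fun _ => (IsParamC.const _).prodMk (hu.mono (subset_univ _))
  · have h4 := hd'.isParamC (isOpen_mul_domain hG e e' φ) (J := J)
      (u := fun x => (e (η x.1), e' (η x.1)⁻¹)) (fun x hx => ?_) m 1 _
      (h1.prodMk h2) fun _ => h3.prodMk (IsParamC.const 0)
    · refine h4.congr hJ fun x hx => ?_
      exact (hasVel_conj hG hd hd' hx.1 hx.2 (u x)).unique (hasVel_adjoint hG _ _)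
    · refine ⟨e.map_source hx.1, e'.map_source hx.2, ?_⟩
      simp only [e.left_inv hx.1, e'.left_inv hx.2, mul_inv_cancel]
      exact mem_chart_source E 1
  · refine ⟨e.map_source hx.1, φ.map_source (mem_chart_source E 1), ?_⟩
    simpa only [e.left_inv hx.1, φ.left_inv (mem_chart_source E 1), mul_one] using hx.1

/-- The smooth curve `t ↦ Ad(η t) (γ t)`. -/
def adjointCurve {η : I → G} (hη : IsSmoothCurve 𝕜 E η) (γ : SmoothCurve 𝕜 E) :
    SmoothCurve 𝕜 E :=
  ⟨fun t => adjoint 𝕜 (η t) (γ t), by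
    have _ := hG.model_t2
    exact IsParamC.isSmoothCurveOn (u := fun z : I × Unit => adjoint 𝕜 (η z.1) (γ z.1))
      (J := univ) isOpen_univ (fun m => isParamC_adjoint hG hη
        (IsParamC.of_isSmoothCurveOn isOpen_univ γ.2)) ()⟩

/-- In the preferred chart, velocities at `1` of products add up. -/
theorem hasVel_chartLine_mul (v w : E) :
    HasVel (chartAt E (1 : G)) (𝓝[≠] (0 : 𝕜)) id (fun r => chartLine G v r * chartLine G w r) 1
      (v + w) := by
  have _ := hG.model_locallyConvex
  have _ := hG.model_t2
  obtain ⟨d, hd⟩ := isSmoothOn_iff.1 (hG.smooth_mul _ (chart_mem_atlas E 1) _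
    (chart_mem_atlas E 1) _ (chart_mem_atlas E (1 : G)))
  have hs : (1 : G) ∈ (chartAt E (1 : G)).source := mem_chart_source E 1
  have hm : ∀ {α κ : 𝕜 → G} {a b : E}, HasVel (chartAt E (1 : G)) (𝓝[≠] (0 : 𝕜)) id α 1 a →
      HasVel (chartAt E (1 : G)) (𝓝[≠] (0 : 𝕜)) id κ 1 b →
      HasVel (chartAt E (1 : G)) (𝓝[≠] (0 : 𝕜)) id (fun r => α r * κ r) 1
        (d 1 (chartAt E (1 : G) 1, chartAt E (1 : G) 1) (fun _ => (a, b))) := fun hα hκ => by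
    have := hasVel_mul hG hd tendsto_id hα hκ (by simp)
    rwa [mul_one] at this
  have h1 := hm (hasVel_chartLine v) (HasVel.const hs)
  have h2 := hm (HasVel.const hs) (hasVel_chartLine w)
  simp only [mul_one] at h1
  simp only [one_mul] at h2
  have h3 := hm (hasVel_chartLine v) (hasVel_chartLine w)
  have hmem : (chartAt E (1 : G) 1, chartAt E (1 : G) 1) ∈
      {p : E × E | p.1 ∈ (chartAt E (1 : G)).target ∧ p.2 ∈ (chartAt E (1 : G)).target ∧
        (chartAt E (1 : G)).symm p.1 * (chartAt E (1 : G)).symm p.2 ∈ (chartAt E (1 : G)).source} :=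
    ⟨(chartAt E (1 : G)).map_source hs, (chartAt E (1 : G)).map_source hs, by
      simp [(chartAt E (1 : G)).left_inv hs]⟩
  -- The differential of multiplication at `(1, 1)` is evaluated on `(v, w) = (v, 0) + (0, w)`; each
  -- summand is known, since multiplying a curve by the constant `1` leaves it unchanged.
  have hadd := hd.update_add (isOpen_mul_domain hG _ _ _) 1 hmem (fun _ => 0) 0 (v, 0) (0, w)
  have e0 : ∀ c : E × E, Function.update (fun _ : Fin 1 => (0 : E × E)) 0 c = fun _ => c :=
    fun c => by
      ext1 j
      rw [Fin.fin_one_eq_zero j, Function.update_self]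
  rw [e0, e0, e0, Prod.mk_add_mk, add_zero, zero_add, h1.unique (hasVel_chartLine v),
    h2.unique (hasVel_chartLine w)] at hadd
  rwa [hadd] at h3

/-- The product rule for logarithmic derivatives: `ζη` has left logarithmic derivative
`Ad(η)⁻¹(Ad(η)(γ - δ)) + δ = γ`. Velocities are compared by means of representative curves, without
inverting `Ad`. -/
theorem IsProductIntegral.mul {γ δ : SmoothCurve 𝕜 E} {ζ η : I → G}
    (hη : IsProductIntegral 𝕜 δ η)
    (hζ : IsProductIntegral 𝕜 (adjointCurve hG hη.1 (γ - δ)) ζ) :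
    IsProductIntegral 𝕜 γ fun t => ζ t * η t := by
  have _ := hG.model_t2
  refine ⟨hζ.1.mul hG hη.1, by simp [hζ.2.1, hη.2.1], fun t => ?_⟩
  obtain ⟨w₁, hw₁, hl₁⟩ := hζ.2.2 t
  obtain ⟨w₂, hw₂, hl₂⟩ := hη.2.2 t
  have hI := tendsto_ofReal_coe_sub (𝕜 := 𝕜) t
  have h0 : Tendsto (id : 𝕜 → 𝕜) (𝓝[≠] 0) (𝓝[≠] 0) := tendsto_id
  have hv₁ := hasVel_of_hasCurveDerivAt hζ.1.1 (mem_chart_source E _) hw₁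
  have hv₂ := hasVel_of_hasCurveDerivAt hη.1.1 (mem_chart_source E _) hw₂
  rw [isLeftTranslate_iff hG] at hl₁ hl₂
  set g := ζ t
  set k := η t
  set v := (γ - δ) t
  -- The line with velocity `Ad(k) v` is replaced by the conjugated line `k · line · k⁻¹`, which has
  -- the same velocity at `1`.
  have hl₁' : HasVel (chartAt E g) (𝓝[≠] (0 : 𝕜)) id
      (fun r => g * (k * chartLine G v r * k⁻¹)) g w₁ := by
    obtain ⟨w, hw, hw'⟩ := exists_hasVel_mul hG (chart_mem_atlas E g) (chart_mem_atlas E 1)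
      (chart_mem_atlas E g) h0 h0 (HasVel.const (mem_chart_source E g))
      (hasVel_chartLine (adjoint 𝕜 k v)) (HasVel.const (mem_chart_source E g))
      (hasVel_adjoint hG k v) (by simp [mem_chart_source E g])
    rw [mul_one] at hw hw'
    rwa [hw.unique hl₁] at hw'
  obtain ⟨W, hW, hW'⟩ := exists_hasVel_mul hG (chart_mem_atlas E g) (chart_mem_atlas E k)
    (chart_mem_atlas E (g * k)) hI h0 hv₁ hv₂ hl₁' hl₂ (mem_chart_source E _)
  refine ⟨W, hW.slope, (isLeftTranslate_iff hG).2 ?_⟩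
  have e1 : v + δ t = γ t := sub_add_cancel (γ t) (δ t)
  have hline := hasVel_chartLine_mul (𝕜 := 𝕜) hG v (δ t)
  rw [e1] at hline
  obtain ⟨w, hw, hw'⟩ := exists_hasVel_mul hG (chart_mem_atlas E (g * k)) (chart_mem_atlas E 1)
    (chart_mem_atlas E (g * k)) h0 h0 (HasVel.const (mem_chart_source E _))
    (hasVel_chartLine (γ t)) (HasVel.const (mem_chart_source E _)) hline
    (by simp [mem_chart_source E (g * k)])
  rw [mul_one] at hw hw'
  -- The inner factors cancel: `g (k a k⁻¹) (k b) = (g k) (a b)`, where `a` and `b` are the lines of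
  -- `v` and `δ t`.
  have e2 : w = W := by
    refine hw'.unique ?_
    convert hW' using 2 with r
    group
  rwa [← e2]

theorem isSmoothCurve_const (g : G) : IsSmoothCurve 𝕜 E fun _ : I => g := by
  refine ⟨continuous_const, fun e _ => ⟨fun k _ => Nat.casesOn k (e g) fun _ => 0,
    fun _ _ => rfl, fun k => ⟨continuousOn_const, fun t _ => ?_⟩⟩⟩
  cases k <;> exact HasCurveDerivAt.const _ t

theorem isProductIntegral_zero : IsProductIntegral 𝕜 (0 : SmoothCurve 𝕜 E) fun _ => (1 : G) := by
  refine ⟨isSmoothCurve_const hG 1, rfl, fun t => ⟨0, HasCurveDerivAt.const _ t, ?_⟩⟩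
  simp [IsLeftTranslate, HasDirDerivAt, show (0 : SmoothCurve 𝕜 E) t = 0 from rfl,
    tendsto_const_nhds]

theorem evol_zero : evol 𝕜 E G 0 = 1 := (isProductIntegral_zero hG).evol_eq hG

/-- If the evolution map is continuous at `0` in the `C^n`-topology, then it is continuous. -/
theorem continuous_evol_of_tendsto
    (hex : ∀ γ : SmoothCurve 𝕜 E, ∃ η : I → G, IsProductIntegral 𝕜 γ η) {n : ℕ}
    (h : Tendsto (evol 𝕜 E G) (@nhds _ (curveTopology 𝕜 E n) 0) (𝓝 1)) :
    Continuous[curveTopology 𝕜 E n, inferInstance] (evol 𝕜 E G) := by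
  have _ := hG.model_t2
  let _ : TopologicalSpace (SmoothCurve 𝕜 E) := curveTopology 𝕜 E n
  refine continuous_iff_continuousAt.2 fun δ => ?_
  obtain ⟨η, hη⟩ := hex δ
  -- The parameter space is the curve space itself with its `C^n`-topology. Evaluation is then a
  -- `C^n`-family, and continuity of `γ ↦ Ad(η)(γ - δ)` becomes a statement about families.
  have hu : IsParamC 𝕜 n (fun z : I × SmoothCurve 𝕜 E => z.2 z.1 - δ z.1) univ := by
    simp only [sub_eq_add_neg]
    refine IsParamC.add (SmoothCurve.isParamC (c := id) fun k hk =>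
      continuous_iterDeriv (by exact_mod_cast hk)) (IsParamC.neg ?_)
    exact IsParamC.of_isSmoothCurveOn isOpen_univ δ.2
  have hβ : Continuous fun γ : SmoothCurve 𝕜 E => adjointCurve hG hη.1 (γ - δ) :=
    SmoothCurve.continuous_of_isParamC (isParamC_adjoint hG hη.1 hu)
  have hβδ : adjointCurve hG hη.1 (δ - δ) = 0 := by
    rw [sub_self]
    exact Subtype.ext (funext fun t => adjoint_zero hG _)
  have h1 := hβ.tendsto δ
  simp only [hβδ] at h1
  have h2 := h.comp h1
  have key : ∀ γ : SmoothCurve 𝕜 E,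
      evol 𝕜 E G γ = evol 𝕜 E G (adjointCurve hG hη.1 (γ - δ)) * evol 𝕜 E G δ := fun γ => by
    obtain ⟨ζ, hζ⟩ := hex (adjointCurve hG hη.1 (γ - δ))
    rw [(hη.mul hG hζ).evol_eq hG, hζ.evol_eq hG, hη.evol_eq hG]
  have h3 := (hG.continuous_mul.tendsto ((1 : G), evol 𝕜 E G δ)).comp
    (h2.prodMk_nhds tendsto_const_nhds)
  simp only [one_mul] at h3
  exact h3.congr fun γ => (key γ).symm

end Evolution

/-! ### Direct sums with the box topology -/

section DirectSum

variable {𝕜 : Type*} [RCLike 𝕜] {ι : Type*}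
variable {E : ι → Type*} [∀ i, AddCommGroup (E i)] [∀ i, TopologicalSpace (E i)]

theorem box_mem_nhds_directSum {x : ⨁ i, E i} {U : ∀ i, Set (E i)} (hU : ∀ i, U i ∈ 𝓝 (x i)) :
    {y : ⨁ i, E i | ∀ i, y i ∈ U i} ∈ 𝓝 x := by
  choose V hVU hV hx using fun i => mem_nhds_iff.1 (hU i)
  exact (mem_nhds_directSum x _).2 ⟨V, hV, hx, fun y hy i => hVU i (hy i)⟩

theorem continuous_directSum_apply (i : ι) : Continuous fun x : ⨁ i, E i => x i := by
  classical
  refine continuous_iff_continuousAt.2 fun x s hs => ?_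
  rw [mem_map]
  refine mem_of_superset (box_mem_nhds_directSum (U := Function.update (fun _ => univ) i s)
    fun j => ?_) fun y hy => ?_
  · by_cases hj : j = i
    · subst hj; simpa using hs
    · simp [Function.update_of_ne hj]
  · simpa using hy i

theorem tendsto_directSum {α : Type*} {l : Filter α} {f : α → ⨁ i, E i} {x : ⨁ i, E i}
    {S : Set ι} (hS : S.Finite) (hf : ∀ i ∈ S, Tendsto (fun a => f a i) l (𝓝 (x i)))
    (hfx : ∀ᶠ a in l, ∀ i ∉ S, f a i = x i) : Tendsto f l (𝓝 x) := by
  intro s hs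
  obtain ⟨U, hU, hx, hUs⟩ := (mem_nhds_directSum x s).1 hs
  have h1 : ∀ᶠ a in l, ∀ i ∈ S, f a i ∈ U i :=
    (eventually_all_finite hS).2 fun i hi => hf i hi ((hU i).mem_nhds (hx i))
  rw [mem_map]
  filter_upwards [h1, hfx] with a ha hfa
  refine hUs fun i => ?_
  by_cases hi : i ∈ S
  · exact ha i hi
  · rw [hfa i hi]
    exact hx i

theorem finite_ne_zero (x : ⨁ i, E i) : {i | x i ≠ 0}.Finite := by
  classical
  refine (DFinsupp.support x).finite_toSet.subset fun i hi => ?_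
  exact DFinsupp.mem_support_toFun x i |>.2 hi

instance t2Space_directSum [∀ i, T2Space (E i)] : T2Space (⨁ i, E i) :=
  T2Space.of_injective_continuous (f := fun (x : ⨁ i, E i) i => x i)
    (fun _ _ h => DFinsupp.ext fun i => congrFun h i)
    (continuous_pi fun i => continuous_directSum_apply i)

variable [∀ i, Module 𝕜 (E i)] [∀ i, IsTopologicalAddGroup (E i)] [∀ i, ContinuousSMul 𝕜 (E i)]

section Polynormable

theorem bddAbove_seminorm_apply (p : ∀ i, Seminorm 𝕜 (E i)) (x : ⨁ i, E i) :
    BddAbove (range fun i => p i (x i)) := by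
  refine Set.Finite.bddAbove ((((finite_ne_zero x).image fun i => p i (x i)).union
    (finite_singleton 0)).subset ?_)
  rintro _ ⟨i, rfl⟩
  by_cases hi : x i = 0
  · right; simp [hi]
  · left; exact ⟨i, hi, rfl⟩

/-- The maximum of seminorms on the summands. -/
def supSeminorm (p : ∀ i, Seminorm 𝕜 (E i)) : Seminorm 𝕜 (⨁ i, E i) :=
  Seminorm.ofSMulLE (fun x => ⨆ i, p i (x i)) (by simp)
    (fun x y => Real.iSup_le (fun i => (map_add_le_add (p i) (x i) (y i)).trans
      (add_le_add (le_ciSup (bddAbove_seminorm_apply p x) i)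
        (le_ciSup (bddAbove_seminorm_apply p y) i)))
      (add_nonneg (Real.iSup_nonneg fun i => apply_nonneg _ _)
        (Real.iSup_nonneg fun i => apply_nonneg _ _)))
    (fun r x => Real.iSup_le (fun i => by
        change p i (r • x i) ≤ _
        rw [map_smul_eq_mul]
        exact mul_le_mul_of_nonneg_left (le_ciSup (bddAbove_seminorm_apply p x) i) (norm_nonneg _))
      (mul_nonneg (norm_nonneg _) (Real.iSup_nonneg fun i => apply_nonneg _ _)))

theorem le_supSeminorm (p : ∀ i, Seminorm 𝕜 (E i)) (x : ⨁ i, E i) (i : ι) :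
    p i (x i) ≤ supSeminorm p x :=
  le_ciSup (bddAbove_seminorm_apply p x) i

theorem supSeminorm_le (p : ∀ i, Seminorm 𝕜 (E i)) {x : ⨁ i, E i} {r : ℝ} (hr : 0 ≤ r)
    (h : ∀ i, p i (x i) ≤ r) : supSeminorm p x ≤ r :=
  Real.iSup_le h hr

/-- A basic neighbourhood is a ball of radius `r` for a finite supremum of continuous seminorms.
Rescaling to radius `1` lets a single inequality for the supremum over all summands describe a box.
-/
theorem exists_continuous_seminorm {F : Type*} [AddCommGroup F] [Module 𝕜 F] [TopologicalSpace F]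
    [PolynormableSpace 𝕜 F] {U : Set F} (hU : U ∈ 𝓝 0) :
    ∃ p : Seminorm 𝕜 F, Continuous p ∧ ∀ x, p x < 1 → x ∈ U := by
  obtain ⟨⟨s, r⟩, hr, hs⟩ :=
    (PolynormableSpace.withSeminorms 𝕜 F).hasBasis_zero_ball.mem_iff.1 hU
  have hr' : 0 < r := hr
  have hc : ∀ s : Finset {p : Seminorm 𝕜 F // Continuous p},
      Continuous ((s.sup fun p : {p : Seminorm 𝕜 F // Continuous p} => p.1) : Seminorm 𝕜 F) := fun s => by
    classical
    induction s using Finset.induction_on with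
    | empty =>
      rw [Finset.sup_empty, Seminorm.bot_eq_zero]
      exact continuous_const
    | insert q s _ ih =>
      rw [Finset.sup_insert]
      exact q.2.sup ih
  refine ⟨(r⁻¹.toNNReal) • s.sup fun p : {p : Seminorm 𝕜 F // Continuous p} => p.1, ?_,
    fun x hx => hs ?_⟩
  · exact (hc s).const_smul _
  · rw [Seminorm.mem_ball_zero]
    rw [smul_apply, NNReal.smul_def, Real.coe_toNNReal _ (inv_nonneg.2 hr'.le),
      smul_eq_mul, inv_mul_lt_iff₀ hr', mul_one] at hx
    exact hx

instance polynormableSpace_directSum [∀ i, PolynormableSpace 𝕜 (E i)] :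
    PolynormableSpace 𝕜 (⨁ i, E i) := by
  -- The defining family is indexed by independent choices of one continuous seminorm on each
  -- summand; this independence produces the box topology.
  have h : WithSeminorms (fun p : (∀ i, {p : Seminorm 𝕜 (E i) // Continuous p}) =>
      supSeminorm fun i => (p i).1) := by
    refine (SeminormFamily.withSeminorms_iff_nhds_eq_iInf _).2 (le_antisymm ?_ fun s hs => ?_)
    · refine le_iInf fun p => ?_
      refine Filter.tendsto_iff_comap.1 ?_
      rw [Metric.tendsto_nhds]
      intro ε hε
      refine mem_of_superset (box_mem_nhds_directSum (U := fun i => {v | (p i).1 v < ε / 2})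
        fun i => ?_) fun x hx => ?_
      · exact (p i).2.tendsto _ (gt_mem_nhds (by simpa using half_pos hε))
      · have := supSeminorm_le (fun i => (p i).1) (half_pos hε).le fun i => (hx i).le
        change dist (supSeminorm (fun i => (p i).1) x) 0 < ε
        rw [Real.dist_eq, sub_zero, abs_of_nonneg (apply_nonneg _ _)]
        linarith
    · obtain ⟨U, hU, h0, hUs⟩ := (mem_nhds_directSum 0 s).1 hs
      choose p hp hpU using fun i =>
        exists_continuous_seminorm (𝕜 := 𝕜) ((hU i).mem_nhds (h0 i))
      refine mem_iInf_of_mem (fun i => ⟨p i, hp i⟩) ⟨{r | r < 1}, gt_mem_nhds one_pos, ?_⟩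
      intro x hx
      exact hUs fun i => hpU i _ ((le_supSeminorm p x i).trans_lt hx)
  exact h.toPolynormableSpace

end Polynormable

/-! ### Smooth maps into direct sums -/

variable {F : ι → Type*} [∀ i, AddCommGroup (F i)] [∀ i, TopologicalSpace (F i)]
  [∀ i, Module 𝕜 (F i)] [∀ i, IsTopologicalAddGroup (F i)] [∀ i, ContinuousSMul 𝕜 (F i)]

/-- A map into a direct sum is smooth if its components are smooth functions of coordinates on the
domain, almost all of which vanish at each point, and for which boxes are neighbourhoods. -/
theorem isSmoothOn_directSum [∀ i, T2Space (F i)]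
    {X : Type*} [AddCommGroup X] [Module 𝕜 X] [TopologicalSpace X] [IsTopologicalAddGroup X]
    [ContinuousSMul 𝕜 X] (π : ∀ i, X →ₗ[𝕜] E i) (hfin : ∀ x, {i | π i x ≠ 0}.Finite)
    (hbox : ∀ (x : X) (V : ∀ i, Set (E i)), (∀ i, V i ∈ 𝓝 (π i x)) → {y | ∀ i, π i y ∈ V i} ∈ 𝓝 x)
    {f : X → ⨁ i, F i} {g : ∀ i, E i → F i} {U : ∀ i, Set (E i)} (hU : ∀ i, IsOpen (U i))
    (hg : ∀ i, IsSmoothOn 𝕜 (g i) (U i)) (hfg : ∀ x i, f x i = g i (π i x)) :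
    IsSmoothOn 𝕜 f {x | ∀ i, π i x ∈ U i} := by
  classical
  choose d hd using fun i => isSmoothOn_iff.1 (hg i)
  -- A derivative in direction `0` vanishes. Hence derivatives of positive order have components
  -- only where the last direction does, so they lie in the direct sum; order zero is covered by `f`
  -- itself.
  have hzero : ∀ i k (x : E i), x ∈ U i → ∀ y : Fin (k + 1) → E i, y (Fin.last k) = 0 →
      d i (k + 1) x y = 0 := fun i k x hx y hy => by
    refine hasDirDerivAt_unique ((hd i).succ k x hx y) ?_
    simp [HasDirDerivAt, hy]
  have hDfin : ∀ k (x : X), (∀ i, π i x ∈ U i) → ∀ y : Fin k → X,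
      {i | d i k (π i x) (fun j => π i (y j)) ≠ 0}.Finite := fun k x hx y => by
    cases k with
    | zero =>
      refine (finite_ne_zero (f x)).subset fun i hi => ?_
      rw [mem_ofPred_eq, (hd i).zero _ (hx i), ← hfg] at hi
      exact hi
    | succ k => exact (hfin (y (Fin.last k))).subset fun i hi h0 => hi (hzero i k _ (hx i) _ h0)
  let D : (k : ℕ) → X → (Fin k → X) → ⨁ i, F i := fun k x y =>
    if h : {i | d i k (π i x) (fun j => π i (y j)) ≠ 0}.Finite then
      DFinsupp.mk h.toFinset fun i => d i k (π i x) (fun j => π i (y j)) else 0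
  have hD : ∀ k (x : X), (∀ i, π i x ∈ U i) → ∀ (y : Fin k → X) i,
      D k x y i = d i k (π i x) (fun j => π i (y j)) := fun k x hx y i => by
    have h := hDfin k x hx y
    simp only [D, dif_pos h]
    refine (DFinsupp.mk_apply ..).trans ?_
    split_ifs with hi
    · rfl
    · by_contra hne
      exact hi (h.mem_toFinset.2 (Ne.symm hne))
  refine isSmoothOn_iff.2 ⟨D, ⟨fun x hx y => DFinsupp.ext fun i => ?_, fun k x hx y => ?_,
    fun k => ?_⟩⟩
  · exact (hD 0 x hx y i).trans (((hd i).zero _ (hx i) _).trans (hfg x i).symm)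
  · have hev : ∀ᶠ t : 𝕜 in 𝓝[≠] 0, ∀ i, π i (x + t • y (Fin.last k)) ∈ U i :=
      tendsto_add_smul x (y (Fin.last k)) (hbox x U fun i => (hU i).mem_nhds (hx i))
    have hcomp : ∀ i, ∀ t : 𝕜, (∀ i, π i (x + t • y (Fin.last k)) ∈ U i) →
        (t⁻¹ • (D k (x + t • y (Fin.last k)) (Fin.init y) - D k x (Fin.init y))) i
        = t⁻¹ • (d i k (π i x + t • π i (y (Fin.last k))) (Fin.init fun j => π i (y j))
          - d i k (π i x) (Fin.init fun j => π i (y j))) := fun i t ht => by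
      change t⁻¹ • (D k (x + t • y (Fin.last k)) (Fin.init y) i - D k x (Fin.init y) i) = _
      rw [hD k _ ht, hD k _ hx, map_add, map_smul]
      rfl
    -- Off the finite support of the last direction the quotient is identically zero for small `t`,
    -- so only finitely many componentwise limits are needed.
    refine tendsto_directSum (hfin (y (Fin.last k))) (fun i _ => ?_) ?_
    · rw [hD (k + 1) x hx]
      refine ((hd i).succ k _ (hx i) fun j => π i (y j)).congr' ?_
      filter_upwards [hev] with t ht
      exact (hcomp i t ht).symm
    · filter_upwards [hev] with t ht i hi
      have hi' : π i (y (Fin.last k)) = 0 := by simpa using hi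
      rw [hcomp i t ht, hD (k + 1) x hx, hzero i k _ (hx i) _ hi', hi']
      simp
  · rintro ⟨x, y⟩ ⟨hx, -⟩ s hs
    obtain ⟨W, hW, hxW, hWs⟩ := (mem_nhds_directSum _ s).1 hs
    -- Joint continuity involves all components at once, but a box permits an independent choice of
    -- neighbourhoods in each.
    have h1 : ∀ i, ∃ V ∈ 𝓝 (π i x), ∃ B : Fin k → Set (E i), (∀ j, B j ∈ 𝓝 (π i (y j))) ∧
        ∀ a ∈ V, ∀ b : Fin k → E i, (∀ j, b j ∈ B j) → d i k a b ∈ W i := fun i => by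
      have hc := ((hd i).continuousAt (hU i) k (hx i) fun j => π i (y j))
      have hmem := hxW i
      rw [hD k x hx] at hmem
      have := hc.preimage_mem_nhds ((hW i).mem_nhds hmem)
      rw [nhds_prod_eq, mem_prod_iff] at this
      obtain ⟨V, hV, A, hA, hVA⟩ := this
      rw [nhds_pi, Filter.mem_pi] at hA
      obtain ⟨K, -, B, hB, hBA⟩ := hA
      exact ⟨V, hV, B, hB, fun a ha b hb => hVA (mk_mem_prod ha (hBA fun j _ => hb j))⟩
    choose V hV B hB hVB using h1
    have h2 : {x' | ∀ i, π i x' ∈ V i} ×ˢ (univ.pi fun j => {y' | ∀ i, π i y' ∈ B i j})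
        ∈ 𝓝 (x, y) :=
      prod_mem_nhds (hbox x V hV) (set_pi_mem_nhds finite_univ fun j _ =>
        hbox (y j) (fun i => B i j) fun i => hB i j)
    rw [mem_map]
    filter_upwards [mem_nhdsWithin_of_mem_nhds h2, self_mem_nhdsWithin] with q hq hqU
    refine hWs fun i => ?_
    rw [hD k _ hqU.1]
    exact hVB i _ (hq.1 i) _ fun j => hq.2 j (mem_univ _) i

/-- With `prod_box_mem_nhds`, this allows `isSmoothOn_directSum` to be applied with coordinates in
`E i × E i`, as multiplication requires. -/
theorem finite_prod_ne_zero (p : (⨁ i, E i) × ⨁ i, E i) :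
    {i | ((p.1 i, p.2 i) : E i × E i) ≠ 0}.Finite := by
  refine ((finite_ne_zero p.1).union (finite_ne_zero p.2)).subset fun i hi => ?_
  by_contra hcon
  simp only [mem_union, mem_ofPred_eq, not_or, not_not] at hcon
  exact hi (Prod.ext hcon.1 hcon.2)

theorem prod_box_mem_nhds (p : (⨁ i, E i) × ⨁ i, E i) (V : ∀ i, Set (E i × E i))
    (hV : ∀ i, V i ∈ 𝓝 (p.1 i, p.2 i)) : {q | ∀ i, (q.1 i, q.2 i) ∈ V i} ∈ 𝓝 p := by
  choose A hA B hB hAB using fun i => mem_nhds_prod_iff.1 (hV i)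
  refine mem_of_superset (prod_mem_nhds (box_mem_nhds_directSum hA) (box_mem_nhds_directSum hB))
    fun q hq i => hAB i (mk_mem_prod (hq.1 i) (hq.2 i))

/-- Transfers smoothness from the atlas of `H i` to the centred charts, which differ from preferred
charts by translations and need not belong to the atlas. -/
theorem IsSmoothOn.translate {X Y : Type*} [AddCommGroup X] [Module 𝕜 X] [TopologicalSpace X]
    [IsTopologicalAddGroup X] [ContinuousSMul 𝕜 X] [AddCommGroup Y] [Module 𝕜 Y]
    [TopologicalSpace Y] [IsTopologicalAddGroup Y] [ContinuousSMul 𝕜 Y] {f : X → Y} {U : Set X} (hf : IsSmoothOn 𝕜 f U) (a : X) (b : Y) :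
    IsSmoothOn 𝕜 (fun x => f (x + a) + b) {x | x + a ∈ U} := by
  obtain ⟨d, hd⟩ := isSmoothOn_iff.1 hf
  refine isSmoothOn_iff.2 ⟨fun k x y => d k (x + a) y + if k = 0 then b else 0,
    ⟨fun x hx y => ?_, fun k x hx y => ?_, fun k => ?_⟩⟩
  · simp [hd.zero _ hx]
  · refine (Tendsto.congr (fun t => ?_) (hd.succ k _ hx y)).trans (by simp)
    rw [add_sub_add_right_eq_sub, add_right_comm]
  · refine ContinuousOn.add ((hd.cont k).comp (f := fun p : X × (Fin k → X) => (p.1 + a, p.2))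
      (by fun_prop) fun p hp => ⟨hp.1, mem_univ _⟩) continuousOn_const

end DirectSum

/-! ### The Lie group structure on weak direct products -/

namespace WeakDirectProduct

section CentredChart

variable {E : Type*} [AddCommGroup E] [TopologicalSpace E] [IsTopologicalAddGroup E]
  {G : Type*} [TopologicalSpace G] [ChartedSpace E G]

theorem centredChart_apply (g x : G) :
    centredChart E g x = chartAt E g x + -(chartAt E g g) := rfl

theorem centredChart_symm_apply (g : G) (v : E) :
    (centredChart E g).symm v = (chartAt E g).symm (v + chartAt E g g) := by
  change (chartAt E g).symm (v + -(-(chartAt E g g))) = _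
  rw [neg_neg]

theorem centredChart_source (g : G) : (centredChart E g).source = (chartAt E g).source := rfl

theorem mem_centredChart_target (g : G) (v : E) :
    v ∈ (centredChart E g).target ↔ v + chartAt E g g ∈ (chartAt E g).target := by
  change v + -(-(chartAt E g g)) ∈ (chartAt E g).target ↔ _
  rw [neg_neg]

end CentredChart

variable {𝕜 : Type*} [RCLike 𝕜] {ι : Type*} [DecidableEq ι]
variable {E : ι → Type*} [∀ i, AddCommGroup (E i)] [∀ i, TopologicalSpace (E i)]
  [∀ i, Module 𝕜 (E i)] [∀ i, IsTopologicalAddGroup (E i)] [∀ i, ContinuousSMul 𝕜 (E i)]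
variable {H : ι → Type*} [∀ i, Group (H i)] [∀ i, TopologicalSpace (H i)]

theorem continuous_apply (i : ι) : Continuous fun x : WeakDirectProduct H => x i := by
  refine continuous_iff_continuousAt.2 fun x s hs => ?_
  obtain ⟨U, hUs, hU, hx⟩ := mem_nhds_iff.1 hs
  rw [mem_map]
  refine (mem_nhds x _).2 ⟨Function.update (fun _ => univ) i U, fun j => ?_, fun j => ?_,
    fun y hy => hUs ?_⟩
  · by_cases hj : j = i
    · subst hj; simpa using hU
    · simp [Function.update_of_ne hj]
  · by_cases hj : j = i
    · subst hj; simpa using hx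
    · simp [Function.update_of_ne hj]
  · simpa using hy i

theorem tendsto_of_finite {α : Type*} {l : Filter α} {f : α → WeakDirectProduct H}
    {x : WeakDirectProduct H} {S : Set ι} (hS : S.Finite)
    (hf : ∀ i ∈ S, Tendsto (fun a => f a i) l (𝓝 (x i)))
    (hfx : ∀ a, ∀ i ∉ S, f a i = x i) : Tendsto f l (𝓝 x) := by
  intro s hs
  obtain ⟨U, hU, hx, hUs⟩ := (mem_nhds x s).1 hs
  have h1 : ∀ᶠ a in l, ∀ i ∈ S, f a i ∈ U i :=
    (eventually_all_finite hS).2 fun i hi => hf i hi ((hU i).mem_nhds (hx i))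
  rw [mem_map]
  filter_upwards [h1] with a ha
  refine hUs fun i => ?_
  by_cases hi : i ∈ S
  · exact ha i hi
  · rw [hfx a i hi]
    exact hx i

variable [∀ i, ChartedSpace (E i) (H i)]
variable (hLie : ∀ i, IsLieGroup 𝕜 (E i) (H i))
include hLie

/-- In box charts every structure map acts componentwise on a box, so each smoothness axiom follows
from that of the factors by `isSmoothOn_directSum`. -/
theorem isLieGroup : IsLieGroup 𝕜 (⨁ i, E i) (WeakDirectProduct H) where
  model_t2 := by
    have _ := fun i => (hLie i).model_t2
    infer_instance
  model_locallyConvex := by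
    have _ := fun i => (hLie i).model_locallyConvex
    infer_instance
  t2 := by
    have _ := fun i => (hLie i).t2
    exact T2Space.of_injective_continuous (f := fun (x : WeakDirectProduct H) i => x i)
      (fun _ _ h => Subtype.ext h) (continuous_pi fun i => continuous_apply i)
  smooth_transition := by
    rintro _ ⟨x, rfl⟩ _ ⟨x', rfl⟩
    have _ := fun i => (hLie i).model_t2
    have hs : ∀ i, IsSmoothOn 𝕜
        (fun v => centredChart (E i) (x' i) ((centredChart (E i) (x i)).symm v))
        {v | v ∈ (centredChart (E i) (x i)).target ∧
          (centredChart (E i) (x i)).symm v ∈ (centredChart (E i) (x' i)).source} := fun i => by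
      have := ((hLie i).smooth_transition _ (chart_mem_atlas (E i) (x i)) _
        (chart_mem_atlas (E i) (x' i))).translate (chartAt (E i) (x i) (x i))
        (-(chartAt (E i) (x' i) (x' i)))
      simp only [centredChart_apply, centredChart_symm_apply, mem_centredChart_target,
        centredChart_source]
      exact this
    have hU : ∀ i, IsOpen {v : E i | v ∈ (centredChart (E i) (x i)).target ∧
        (centredChart (E i) (x i)).symm v ∈ (centredChart (E i) (x' i)).source} := fun i =>
      (centredChart (E i) (x i)).isOpen_inter_preimage_symm (centredChart (E i) (x' i)).open_source
    convert isSmoothOn_directSum (DirectSum.component 𝕜 ι E) finite_ne_zero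
      (fun x V hV => box_mem_nhds_directSum hV)
      (f := fun v => boxChart E x' ((boxChart E x).symm v)) hU hs (fun v i => toDirectSum_apply E x' _ i) using 1
    ext v
    exact forall_and.symm
  continuous_mul := by
    refine continuous_iff_continuousAt.2 fun p s hs => ?_
    obtain ⟨U, hU, hx, hUs⟩ := (mem_nhds _ s).1 hs
    have h : ∀ i, ∃ V W : Set (H i), IsOpen V ∧ IsOpen W ∧ p.1 i ∈ V ∧ p.2 i ∈ W ∧
        ∀ a ∈ V, ∀ b ∈ W, a * b ∈ U i := fun i => by
      obtain ⟨V, W, hV, hW, h1, h2, h⟩ := isOpen_prod_iff.1 ((hU i).preimage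
        (hLie i).continuous_mul) (p.1 i) (p.2 i) (hx i)
      exact ⟨V, W, hV, hW, h1, h2, fun a ha b hb => h (mk_mem_prod ha hb)⟩
    choose V W hV hW h1 h2 h using h
    rw [mem_map, nhds_prod_eq]
    exact mem_of_superset (prod_mem_prod ((mem_nhds _ _).2 ⟨V, hV, h1, subset_rfl⟩)
      ((mem_nhds _ _).2 ⟨W, hW, h2, subset_rfl⟩)) fun q hq => hUs fun i =>
        h i _ (hq.1 i) _ (hq.2 i)
  continuous_inv := by
    refine continuous_iff_continuousAt.2 fun x s hs => ?_
    obtain ⟨U, hU, hx, hUs⟩ := (mem_nhds _ s).1 hs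
    exact (mem_nhds _ _).2 ⟨fun i => (fun a => a⁻¹) ⁻¹' U i,
      fun i => (hU i).preimage (hLie i).continuous_inv, hx, fun y hy => hUs hy⟩
  smooth_mul := by
    rintro _ ⟨x₁, rfl⟩ _ ⟨x₂, rfl⟩ _ ⟨x₃, rfl⟩
    have _ := fun i => (hLie i).model_t2
    have hs : ∀ i, IsSmoothOn 𝕜 (fun p : E i × E i => centredChart (E i) (x₃ i)
        ((centredChart (E i) (x₁ i)).symm p.1 * (centredChart (E i) (x₂ i)).symm p.2))
        {p | p.1 ∈ (centredChart (E i) (x₁ i)).target ∧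
          p.2 ∈ (centredChart (E i) (x₂ i)).target ∧
          (centredChart (E i) (x₁ i)).symm p.1 * (centredChart (E i) (x₂ i)).symm p.2 ∈
            (centredChart (E i) (x₃ i)).source} := fun i => by
      have := ((hLie i).smooth_mul _ (chart_mem_atlas (E i) (x₁ i)) _
        (chart_mem_atlas (E i) (x₂ i)) _ (chart_mem_atlas (E i) (x₃ i))).translate
        (chartAt (E i) (x₁ i) (x₁ i), chartAt (E i) (x₂ i) (x₂ i))
        (-(chartAt (E i) (x₃ i) (x₃ i)))
      simp only [centredChart_apply, centredChart_symm_apply, mem_centredChart_target,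
        centredChart_source]
      exact this
    convert isSmoothOn_directSum (E := fun i => E i × E i)
      (fun i => (DirectSum.component 𝕜 ι E i).prodMap (DirectSum.component 𝕜 ι E i))
      finite_prod_ne_zero (fun x V hV => prod_box_mem_nhds x V hV)
      (f := fun p => boxChart E x₃ ((boxChart E x₁).symm p.1 * (boxChart E x₂).symm p.2))
      (fun i => isOpen_mul_domain (hLie i) (centredChart (E i) (x₁ i)) (centredChart (E i) (x₂ i))
        (centredChart (E i) (x₃ i))) hs
      (fun v i => toDirectSum_apply E x₃ _ i) using 1
    ext p
    change (∀ i, _) ∧ (∀ i, _) ∧ (∀ i, _) ↔ ∀ i, _ ∧ _ ∧ _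
    rw [← forall_and, ← forall_and]
    exact Iff.rfl
  smooth_inv := by
    rintro _ ⟨x, rfl⟩ _ ⟨x', rfl⟩
    have _ := fun i => (hLie i).model_t2
    have hs : ∀ i, IsSmoothOn 𝕜
        (fun v => centredChart (E i) (x' i) ((centredChart (E i) (x i)).symm v)⁻¹)
        {v | v ∈ (centredChart (E i) (x i)).target ∧
          ((centredChart (E i) (x i)).symm v)⁻¹ ∈ (centredChart (E i) (x' i)).source} := fun i => by
      have := ((hLie i).smooth_inv _ (chart_mem_atlas (E i) (x i)) _
        (chart_mem_atlas (E i) (x' i))).translate (chartAt (E i) (x i) (x i))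
        (-(chartAt (E i) (x' i) (x' i)))
      simp only [centredChart_apply, centredChart_symm_apply, mem_centredChart_target,
        centredChart_source]
      exact this
    convert isSmoothOn_directSum (DirectSum.component 𝕜 ι E) finite_ne_zero
      (fun x V hV => box_mem_nhds_directSum hV)
      (f := fun v => boxChart E x' ((boxChart E x).symm v)⁻¹) (fun i => isOpen_inv_domain (hLie i)
        (centredChart (E i) (x i)) (centredChart (E i) (x' i))) hs
      (fun v i => toDirectSum_apply E x' _ i) using 1
    ext v
    exact forall_and.symm

omit hLie in
theorem isTangentMap_inclusion (n : ι) :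
    IsTangentMap 𝕜 (E n) (inclusion H n) (DirectSum.lof 𝕜 ι E n) := by
  intro v
  have hch : ∀ x : E n, ∀ i, toDirectSum E 1 (inclusion H n ((chartAt (E n) (1 : H n)).symm x)) i
      = centredChart (E i) (1 : H i) (Pi.mulSingle n ((chartAt (E n) (1 : H n)).symm x) i) :=
    fun x i => toDirectSum_apply E 1 _ i
  have hs : chartAt (E n) (1 : H n) 1 ∈ (chartAt (E n) (1 : H n)).target :=
    mem_chart_target (E n) 1
  refine tendsto_directSum (finite_singleton n) (fun i hi => ?_) (Eventually.of_forall fun t i hi => ?_)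
  · obtain rfl : i = n := hi
    rw [DirectSum.lof_apply]
    refine Tendsto.congr' ?_ (tendsto_const_nhds (x := v))
    filter_upwards [(tendsto_add_smul (𝕜 := 𝕜) (chartAt (E i) (1 : H i) 1) v).eventually
      ((chartAt (E i) (1 : H i)).open_target.mem_nhds hs), self_mem_nhdsWithin] with t ht ht0
    change v = t⁻¹ • (toDirectSum E 1 _ i - toDirectSum E 1 _ i)
    rw [hch, hch, Pi.mulSingle_eq_same, Pi.mulSingle_eq_same, centredChart_apply,
      centredChart_apply, add_sub_add_right_eq_sub, OpenPartialHomeomorph.right_inv _ ht,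
      OpenPartialHomeomorph.right_inv _ hs, add_sub_cancel_left, smul_smul, inv_mul_cancel₀ ht0,
      one_smul]
  · have hi' : i ≠ n := hi
    change t⁻¹ • (toDirectSum E 1 _ i - toDirectSum E 1 _ i) = _
    rw [hch, hch, Pi.mulSingle_eq_of_ne hi', Pi.mulSingle_eq_of_ne hi', sub_self, smul_zero]
    exact (DirectSum.of_eq_of_ne n i v hi').symm

end WeakDirectProduct

/-! ### Mackey completeness of direct sums -/

section Mackey

variable {𝕜 : Type*} [RCLike 𝕜] {ι : Type*}
variable {E : ι → Type*} [∀ i, AddCommGroup (E i)] [∀ i, TopologicalSpace (E i)]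
  [∀ i, Module 𝕜 (E i)] [∀ i, IsTopologicalAddGroup (E i)] [∀ i, ContinuousSMul 𝕜 (E i)]

/-- Compact sets are contained in finite partial sums. -/
theorem finite_support_of_isCompact [∀ i, T1Space (E i)] {C : Set (⨁ i, E i)} (hC : IsCompact C) :
    {i | ∃ x ∈ C, x i ≠ 0}.Finite := by
  classical
  -- For each active index `i` a witness `a i` in `C` is fixed. Compact induction then bounds the
  -- number of indices whose witness lies in a given set.
  have hex : ∀ i, ∃ x : ⨁ i, E i, (∃ x ∈ C, x i ≠ 0) → x ∈ C ∧ x i ≠ 0 := fun i => by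
    by_cases h : ∃ x ∈ C, x i ≠ 0
    · obtain ⟨x, hx⟩ := h
      exact ⟨x, fun _ => hx⟩
    · exact ⟨0, fun h' => absurd h' h⟩
  choose a ha using hex
  set S := {i | ∃ x ∈ C, x i ≠ 0}
  have key := hC.induction_on (p := fun s => {i | i ∈ S ∧ a i ∈ s}.Finite) (by simp)
    (fun s t hst ht => ht.subset fun i hi => ⟨hi.1, hst hi.2⟩)
    (fun s t hs ht => (hs.union ht).subset fun i hi => hi.2.imp (fun h => ⟨hi.1, h⟩)
      fun h => ⟨hi.1, h⟩) fun x _ => ?_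
  · exact key.subset fun i hi => ⟨hi, (ha i hi).1⟩
  · refine ⟨_, mem_nhdsWithin_of_mem_nhds (box_mem_nhds_directSum
      (U := fun i => {v | x i = 0 → i ∈ S → v ≠ a i i}) fun i => ?_), ?_⟩
    · by_cases hxi : x i = 0
      · by_cases hi : i ∈ S
        · filter_upwards [isOpen_ne.mem_nhds (hxi ▸ (ha i hi).2.symm : x i ≠ a i i)] with v hv _ _
          exact hv
        · exact univ_mem' fun v _ h => absurd h hi
      · exact univ_mem' fun v h => absurd h hxi
    · refine (finite_ne_zero x).subset fun i hi hxi => ?_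
      exact hi.2 i hxi hi.1 rfl

theorem exists_directSum_eq (w : ∀ i, E i) (hw : {i | w i ≠ 0}.Finite) :
    ∃ v : ⨁ i, E i, ∀ i, v i = w i := by
  classical
  refine ⟨DFinsupp.mk hw.toFinset fun i => w i, fun i => (DFinsupp.mk_apply ..).trans ?_⟩
  split_ifs with h
  · rfl
  · simpa [eq_comm] using h

/-- The coordinate projections of a direct sum. -/
def directSumProj (𝕜 : Type*) [RCLike 𝕜] {ι : Type*} (E : ι → Type*) [∀ i, AddCommGroup (E i)]
    [∀ i, TopologicalSpace (E i)] [∀ i, Module 𝕜 (E i)] (i : ι) : (⨁ i, E i) →L[𝕜] E i :=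
  ⟨DirectSum.component 𝕜 ι E i, continuous_directSum_apply i⟩

/-- The inclusions of the summands of a direct sum. -/
def directSumIncl (𝕜 : Type*) [RCLike 𝕜] {ι : Type*} [DecidableEq ι] (E : ι → Type*)
    [∀ i, AddCommGroup (E i)] [∀ i, TopologicalSpace (E i)] [∀ i, Module 𝕜 (E i)] (i : ι) :
    E i →L[𝕜] ⨁ i, E i :=
  ⟨DirectSum.lof 𝕜 ι E i, continuous_iff_continuousAt.2 fun v =>
    tendsto_directSum (finite_singleton i) (fun j hj => by
      obtain rfl : j = i := hj
      refine Tendsto.congr (f₁ := id) (fun w => (DirectSum.lof_apply 𝕜 j w).symm) ?_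
      have e : ((DirectSum.lof 𝕜 ι E j).toFun v) j = v := DirectSum.lof_apply 𝕜 j v
      rw [e]
      exact tendsto_id) (Eventually.of_forall fun w j hj => by
        have hj' : j ≠ i := hj
        exact (DirectSum.of_eq_of_ne i j w hj').trans (DirectSum.of_eq_of_ne i j v hj').symm)⟩

section Map

variable {X Y : Type*} [AddCommGroup X] [Module 𝕜 X] [TopologicalSpace X]
  [IsTopologicalAddGroup X] [ContinuousSMul 𝕜 X] [AddCommGroup Y] [Module 𝕜 Y]
  [TopologicalSpace Y] [IsTopologicalAddGroup Y] [ContinuousSMul 𝕜 Y]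

theorem HasCurveDerivAt.map {T : Set ℝ} {c : T → X} {v : X} {t : T} (h : HasCurveDerivAt 𝕜 c v t)
    (L : X →L[𝕜] Y) : HasCurveDerivAt 𝕜 (fun s => L (c s)) (L v) t :=
  ((L.continuous.tendsto v).comp h).congr fun s => by simp

theorem IsSmoothCurveOn.map {T : Set ℝ} {c : T → X} {J : Set T} (h : IsSmoothCurveOn 𝕜 c J)
    (L : X →L[𝕜] Y) : IsSmoothCurveOn 𝕜 (fun s => L (c s)) J := by
  obtain ⟨D, hD0, hD⟩ := h
  exact ⟨fun k t => L (D k t), fun t ht => by simp [hD0 ht], fun k =>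
    ⟨L.continuous.comp_continuousOn (hD k).1, fun t ht => ((hD k).2 t ht).map L⟩⟩

theorem IsSmoothCurveOn.mono {T : Set ℝ} {c : T → X} {J J' : Set T} (h : IsSmoothCurveOn 𝕜 c J)
    (hJ : J' ⊆ J) : IsSmoothCurveOn 𝕜 c J' := by
  obtain ⟨D, hD0, hD⟩ := h
  exact ⟨D, hD0.mono hJ, fun k => ⟨(hD k).1.mono hJ, fun t ht => (hD k).2 t (hJ ht)⟩⟩

theorem IsSmoothCurveOn.add_const {T : Set ℝ} {c : T → X} {J : Set T} (h : IsSmoothCurveOn 𝕜 c J)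
    (b : X) : IsSmoothCurveOn 𝕜 (fun s => c s + b) J := by
  obtain ⟨D, hD0, hD⟩ := h
  refine ⟨fun k t => D k t + if k = 0 then b else 0, fun t ht => by simp [hD0 ht], fun k =>
    ⟨(hD k).1.add continuousOn_const, fun t ht => ?_⟩⟩
  simpa using ((hD k).2 t ht).add (HasCurveDerivAt.const (𝕜 := 𝕜) (if k = 0 then b else 0) t)

/-- The image of a smooth curve under a continuous linear map. -/
def SmoothCurve.map (L : X →L[𝕜] Y) (γ : SmoothCurve 𝕜 X) : SmoothCurve 𝕜 Y :=
  ⟨fun t => L (γ t), IsSmoothCurveOn.map γ.2 L⟩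

theorem SmoothCurve.iterDeriv_map [T2Space Y] (L : X →L[𝕜] Y) (γ : SmoothCurve 𝕜 X) (k : ℕ)
    (t : I) : SmoothCurve.iterDeriv k (γ.map L) t = L (SmoothCurve.iterDeriv k γ t) :=
  SmoothCurve.iterDeriv_eq (n := k) (D := fun k t => L (SmoothCurve.iterDeriv k γ t))
    (fun t => by rw [SmoothCurve.iterDeriv_zero]; rfl)
    (fun k _ t => (γ.hasCurveDerivAt_iterDeriv k t).map L) k le_rfl t

theorem SmoothCurve.continuous (γ : SmoothCurve 𝕜 X) : Continuous (γ : I → X) :=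
  (SmoothCurve.iterDeriv 0 γ).continuous.congr fun t => γ.iterDeriv_zero t

end Map

theorem isMackeyComplete_directSum [∀ i, T1Space (E i)] (h : ∀ i, IsMackeyComplete 𝕜 (E i)) :
    IsMackeyComplete 𝕜 (⨁ i, E i) := by
  classical
  intro γ hγ
  have hcont : Continuous γ := by
    obtain ⟨D, hD0, hD⟩ := hγ
    have h1 := continuousOn_univ.1 ((hD 0).1.congr hD0.symm)
    exact h1.comp (Homeomorph.Set.univ ℝ).symm.continuous
  have hfin := finite_support_of_isCompact ((isCompact_Icc (a := (0 : ℝ)) (b := 1)).image hcont)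
  set S := {i | ∃ x ∈ γ '' Icc 0 1, x i ≠ 0}
  choose v hv using fun i => h i (fun t => γ t i) (hγ.map (directSumProj 𝕜 E i))
  obtain ⟨w, hw⟩ := exists_directSum_eq (fun i => if i ∈ S then v i else 0)
    (hfin.subset fun i hi => by by_contra hc; simp [hc] at hi)
  refine ⟨w, fun W hW => ?_⟩
  obtain ⟨U, hU, hwU, hUW⟩ := (mem_nhds_directSum w W).1 hW
  -- Finiteness of `S` yields one mesh bound for all active components. The remaining components of
  -- the Riemann sums vanish, since the tags lie in `[0,1]`.
  have hev : ∀ᶠ δ : ℝ in 𝓝[>] 0, ∀ i ∈ S, ∀ (m : ℕ) (t : Fin (m + 1) → ℝ) (ξ : Fin m → ℝ),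
      Monotone t → t 0 = 0 → t (Fin.last m) = 1 →
      (∀ j : Fin m, t j.castSucc ≤ ξ j ∧ ξ j ≤ t j.succ) →
      (∀ j : Fin m, t j.succ - t j.castSucc < δ) →
      ∑ j : Fin m, ((t j.succ - t j.castSucc : ℝ) : 𝕜) • γ (ξ j) i ∈ U i := by
    refine (eventually_all_finite hfin).2 fun i hi => ?_
    have hwi := hwU i
    rw [hw, if_pos hi] at hwi
    obtain ⟨δ, hδ, hR⟩ := hv i (U i) ((hU i).mem_nhds hwi)
    filter_upwards [Ioo_mem_nhdsGT hδ] with ε hε m t ξ h1 h2 h3 h4 h5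
    exact hR m t ξ h1 h2 h3 h4 fun j => (h5 j).trans hε.2
  obtain ⟨δ, hR, hδ⟩ := (hev.and self_mem_nhdsWithin).exists
  refine ⟨δ, hδ, fun m t ξ h1 h2 h3 h4 h5 => hUW fun i => ?_⟩
  have hsum : (∑ j : Fin m, ((t j.succ - t j.castSucc : ℝ) : 𝕜) • γ (ξ j)) i
      = ∑ j : Fin m, ((t j.succ - t j.castSucc : ℝ) : 𝕜) • γ (ξ j) i := by
    change directSumProj 𝕜 E i _ = _
    rw [map_sum]
    exact Finset.sum_congr rfl fun j _ => map_smul _ _ _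
  rw [hsum]
  by_cases hi : i ∈ S
  · exact hR i hi m t ξ h1 h2 h3 h4 h5
  · have hz : ∀ j, γ (ξ j) i = 0 := fun j => by
      by_contra hne
      refine hi ⟨_, ⟨ξ j, ⟨?_, ?_⟩, rfl⟩, hne⟩
      · exact (h2.symm.le.trans (h1 (Fin.zero_le _))).trans (h4 j).1
      · exact (h4 j).2.trans ((h1 (Fin.le_last _)).trans h3.le)
    have hwi := hwU i
    rw [hw, if_neg hi] at hwi
    simpa [hz] using hwi

theorem isSmoothCurveOn_directSum {T : Set ℝ} {c : T → ⨁ i, E i} {J : Set T} {S : Set ι}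
    (hS : S.Finite) (hc : ∀ t ∈ J, ∀ i ∉ S, c t i = 0)
    (h : ∀ i, IsSmoothCurveOn 𝕜 (fun t => c t i) J) : IsSmoothCurveOn 𝕜 c J := by
  classical
  choose D hD0 hD using h
  -- The given `D i k` are uncontrolled off `J`, so components outside `S` are set to zero
  -- everywhere.
  have hex : ∀ (k : ℕ) (t : T), ∃ v : ⨁ i, E i, ∀ i, v i = if i ∈ S then D i k t else 0 :=
    fun k t => exists_directSum_eq _ (hS.subset fun i hi => by by_contra hc; simp [hc] at hi)
  choose F hF using hex
  refine ⟨F, fun t ht => DFinsupp.ext fun i => ?_, fun k => ⟨fun t ht => ?_, fun t ht => ?_⟩⟩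
  · refine (hF 0 t i).trans ?_
    split_ifs with hi
    · exact hD0 i ht
    · exact (hc t ht i hi).symm
  · refine tendsto_directSum hS (fun i hi => ?_) (Eventually.of_forall fun s i hi => ?_)
    · simp only [hF, if_pos hi]
      exact (hD i k).1 t ht
    · simp only [hF, if_neg hi]
  · have e : ∀ (s : T) i, (((((s : ℝ) - (t : ℝ) : ℝ) : 𝕜)⁻¹ • (F k s - F k t) : ⨁ i, E i)) i
        = (((s : ℝ) - (t : ℝ) : ℝ) : 𝕜)⁻¹ • (F k s i - F k t i) := fun s i => rfl
    refine tendsto_directSum hS (fun i hi => ?_) (Eventually.of_forall fun s i hi => ?_)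
    · simp only [e, hF, if_pos hi]
      exact (hD i k).2 t ht
    · simp only [e, hF, if_neg hi, sub_self, smul_zero]

end Mackey

/-! ### Product integrals in weak direct products -/

section ProductIntegral

variable {𝕜 : Type*} [RCLike 𝕜] {ι : Type*} [DecidableEq ι]
variable {E : ι → Type*} [∀ i, AddCommGroup (E i)] [∀ i, TopologicalSpace (E i)]
  [∀ i, Module 𝕜 (E i)] [∀ i, IsTopologicalAddGroup (E i)] [∀ i, ContinuousSMul 𝕜 (E i)]
variable {H : ι → Type*} [∀ i, Group (H i)] [∀ i, TopologicalSpace (H i)]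
  [∀ i, ChartedSpace (E i) (H i)]

open WeakDirectProduct

theorem isSmoothCurve_weakDirectProduct {η : I → WeakDirectProduct H} {S : Set ι} (hS : S.Finite)
    (h1 : ∀ t, ∀ i ∉ S, η t i = 1) (h : ∀ i, IsSmoothCurve 𝕜 (E i) fun t => η t i) :
    IsSmoothCurve 𝕜 (⨁ i, E i) η := by
  refine ⟨continuous_iff_continuousAt.2 fun t => tendsto_of_finite hS
    (fun i _ => (h i).1.tendsto t) fun s i hi => (h1 s i hi).trans (h1 t i hi).symm, ?_⟩
  rintro _ ⟨x, rfl⟩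
  -- The chart around `x` sends `1` to `0` only in components with `x i = 1`; the finitely many
  -- others must be added to `S`.
  refine isSmoothCurveOn_directSum (hS.union x.finite_ne_one) (fun t _ i hi => ?_) fun i => ?_
  · simp only [mem_union, not_or, mem_ofPred_eq, not_not] at hi
    refine (toDirectSum_apply E x (η t) i).trans ?_
    rw [h1 t i hi.1, hi.2, centredChart_self]
  · have h2 := (((h i).2 _ (chart_mem_atlas (E i) (x i))).mono
      (J' := η ⁻¹' (boxChart E x).source) fun t ht => ht i).add_const
      (-(chartAt (E i) (x i) (x i)))
    convert h2 using 2 with t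
    exact toDirectSum_apply E x (η t) i

theorem exists_isProductIntegral (hLie : ∀ i, IsLieGroup 𝕜 (E i) (H i))
    (hex : ∀ i (γ : SmoothCurve 𝕜 (E i)), ∃ η : I → H i, IsProductIntegral 𝕜 γ η)
    (γ : SmoothCurve 𝕜 (⨁ i, E i)) :
    ∃ η : I → WeakDirectProduct H, IsProductIntegral 𝕜 γ η ∧
      ∀ i, IsProductIntegral 𝕜 (γ.map (directSumProj 𝕜 E i)) fun t => η t i := by
  classical
  have _ := fun i => (hLie i).model_t2
  have hfin := finite_support_of_isCompact (isCompact_range γ.continuous)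
  set S := {i | ∃ x ∈ range γ.1, x i ≠ 0}
  have hγ : ∀ t, ∀ i ∉ S, γ t i = 0 := fun t i hi => by
    by_contra hne
    exact hi ⟨_, mem_range_self t, hne⟩
  -- Outside `S` the component of `γ` is the zero curve, and the constant `1` is taken explicitly,
  -- so that the assembled curve has values in the weak product.
  have hex' : ∀ i, ∃ η : I → H i, IsProductIntegral 𝕜 (γ.map (directSumProj 𝕜 E i)) η ∧
      (i ∉ S → η = fun _ => 1) := fun i => by
    by_cases hi : i ∈ S
    · obtain ⟨η, hη⟩ := hex i (γ.map (directSumProj 𝕜 E i))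
      exact ⟨η, hη, fun h => absurd hi h⟩
    · refine ⟨fun _ => 1, ?_, fun _ => rfl⟩
      have e : γ.map (directSumProj 𝕜 E i) = 0 := Subtype.ext (funext fun t => hγ t i hi)
      rw [e]
      exact isProductIntegral_zero (hLie i)
  choose ξ hξ hξ1 using hex'
  have hξ1' : ∀ t, ∀ i ∉ S, ξ i t = 1 := fun t i hi => by rw [hξ1 i hi]
  let η : I → WeakDirectProduct H := fun t =>
    ⟨fun i => ξ i t, hfin.subset fun i hi => by_contra fun h => hi (hξ1' t i h)⟩
  refine ⟨η, ⟨isSmoothCurve_weakDirectProduct hfin hξ1' fun i => (hξ i).1,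
    WeakDirectProduct.ext fun i => (hξ i).2.1, fun t => ?_⟩, hξ⟩
  have hv : ∀ i, ∃ w : E i, HasCurveDerivAt 𝕜 (fun s => chartAt (E i) (ξ i t) (ξ i s)) w t ∧
      IsLeftTranslate 𝕜 (E i) (ξ i t) (γ t i) w ∧ (i ∉ S → w = 0) := fun i => by
    obtain ⟨w, hw, hl⟩ := (hξ i).2.2 t
    refine ⟨w, hw, hl, fun hi => ?_⟩
    refine hasCurveDerivAt_unique hw ?_
    rw [hξ1 i hi]
    exact HasCurveDerivAt.const _ t
  choose v hvd hvl hv0 using hv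
  obtain ⟨w, hw⟩ := exists_directSum_eq v (hfin.subset fun i hi => by_contra fun h => hi (hv0 i h))
  refine ⟨w, ?_, ?_⟩
  · have e : ∀ (s : I) i, ((((s : ℝ) - (t : ℝ) : ℝ) : 𝕜)⁻¹ •
        (toDirectSum E (η t) (η s) - toDirectSum E (η t) (η t))) i
        = (((s : ℝ) - (t : ℝ) : ℝ) : 𝕜)⁻¹ •
          (chartAt (E i) (ξ i t) (ξ i s) - chartAt (E i) (ξ i t) (ξ i t)) := fun s i => by
      change (((s : ℝ) - (t : ℝ) : ℝ) : 𝕜)⁻¹ •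
        (toDirectSum E (η t) (η s) i - toDirectSum E (η t) (η t) i) = _
      rw [toDirectSum_apply, toDirectSum_apply, centredChart_apply, centredChart_apply,
        add_sub_add_right_eq_sub]
    refine tendsto_directSum hfin (fun i _ => ?_) (Eventually.of_forall fun s i hi => ?_)
    · rw [hw]
      exact Tendsto.congr (fun s => (e s i).symm) (hvd i)
    · refine (e s i).trans ?_
      rw [hw, hv0 i hi, hξ1' s i hi, hξ1' t i hi, sub_self, smul_zero]
  · have e : ∀ (x : ⨁ i, E i) i, toDirectSum E (η t) (η t * ofDirectSum E 1 x) i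
        = chartAt (E i) (ξ i t) (ξ i t * (chartAt (E i) (1 : H i)).symm
            (x i + chartAt (E i) (1 : H i) 1)) + -(chartAt (E i) (ξ i t) (ξ i t)) := fun x i => by
      rw [toDirectSum_apply, centredChart_apply, ← centredChart_symm_apply]
      rfl
    have e0 : ∀ i, toDirectSum E (1 : WeakDirectProduct H) 1 i = 0 := fun i => by
      rw [toDirectSum_apply, centredChart_self]
    have e1 : ∀ (r : 𝕜) i, (r⁻¹ • (toDirectSum E (η t) (η t * ofDirectSum E 1
          (toDirectSum E (1 : WeakDirectProduct H) 1 + r • γ t))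
        - toDirectSum E (η t) (η t * ofDirectSum E 1
          (toDirectSum E (1 : WeakDirectProduct H) 1)))) i
        = r⁻¹ • (chartAt (E i) (ξ i t) (ξ i t * (chartAt (E i) (1 : H i)).symm
            (chartAt (E i) (1 : H i) 1 + r • γ t i))
          - chartAt (E i) (ξ i t) (ξ i t * (chartAt (E i) (1 : H i)).symm
            (chartAt (E i) (1 : H i) 1))) := fun r i => by
      change r⁻¹ • (toDirectSum E (η t) _ i - toDirectSum E (η t) _ i) = _
      rw [e, e, add_sub_add_right_eq_sub]
      change r⁻¹ • (chartAt (E i) (ξ i t) (ξ i t * (chartAt (E i) (1 : H i)).symm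
        (toDirectSum E (1 : WeakDirectProduct H) 1 i + r • γ t i + _)) - _) = _
      rw [e0, zero_add, zero_add, add_comm]
    refine tendsto_directSum hfin (fun i _ => ?_) (Eventually.of_forall fun r i hi => ?_)
    · rw [hw]
      exact Tendsto.congr (fun r => (e1 r i).symm) (hvl i)
    · refine (e1 r i).trans ?_
      rw [hw, hv0 i hi, hγ t i hi, smul_zero, add_zero, sub_self, smul_zero]

/-- The evolution map of a weak direct product on curves with values in one summand. -/
theorem evol_directSumIncl (hLie : ∀ i, IsLieGroup 𝕜 (E i) (H i))
    (hex : ∀ i (γ : SmoothCurve 𝕜 (E i)), ∃ η : I → H i, IsProductIntegral 𝕜 γ η) (i : ι)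
    (γ : SmoothCurve 𝕜 (E i)) :
    evol 𝕜 (⨁ i, E i) (WeakDirectProduct H) (γ.map (directSumIncl 𝕜 E i)) i
      = evol 𝕜 (E i) (H i) γ := by
  obtain ⟨η, hη, hηi⟩ := exists_isProductIntegral hLie hex (γ.map (directSumIncl 𝕜 E i))
  have e : (γ.map (directSumIncl 𝕜 E i)).map (directSumProj 𝕜 E i) = γ :=
    Subtype.ext (funext fun t => DirectSum.lof_apply 𝕜 i (γ t))
  have h := hηi i
  rw [e] at h
  rw [hη.evol_eq (isLieGroup hLie), h.evol_eq (hLie i)]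

end ProductIntegral

/-! ### Discontinuity of the evolution map -/

section Discontinuity

variable {𝕜 : Type*} [RCLike 𝕜]
variable {E : Type*} [AddCommGroup E] [Module 𝕜 E] [TopologicalSpace E]
  [IsTopologicalAddGroup E] [ContinuousSMul 𝕜 E]

theorem SmoothCurve.iterDeriv_zero_curve [T2Space E] (k : ℕ) (t : I) :
    SmoothCurve.iterDeriv k (0 : SmoothCurve 𝕜 E) t = 0 :=
  SmoothCurve.iterDeriv_eq (n := k) (D := fun _ _ => (0 : E)) (fun _ => rfl)
    (fun _ _ t => HasCurveDerivAt.const 0 t) k le_rfl t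

theorem setOf_iterDeriv_mem_nhds [T2Space E] (n : ℕ) {W : Set E} (hW : W ∈ 𝓝 0) :
    {γ : SmoothCurve 𝕜 E | ∀ k ≤ n, ∀ t, SmoothCurve.iterDeriv k γ t ∈ W} ∈
      @nhds _ (curveTopology 𝕜 E n) 0 := by
  obtain ⟨V, hVW, hV, h0⟩ := mem_nhds_iff.1 hW
  let _ : TopologicalSpace (SmoothCurve 𝕜 E) := curveTopology 𝕜 E n
  have h : ∀ᶠ γ : SmoothCurve 𝕜 E in 𝓝 0, ∀ k ∈ Iic n,
      MapsTo (SmoothCurve.iterDeriv k γ) univ V := by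
    refine (eventually_all_finite (finite_Iic n)).2 fun k hk => ?_
    have hc : Continuous (SmoothCurve.iterDeriv (𝕜 := 𝕜) (E := E) k) :=
      continuous_iterDeriv (by exact_mod_cast hk)
    refine ((ContinuousMap.isOpen_setOfPred_mapsTo isCompact_univ hV).preimage hc).mem_nhds ?_
    intro t _
    rw [SmoothCurve.iterDeriv_zero_curve]
    exact h0
  filter_upwards [h] with γ hγ k hk t
  exact hVW (hγ k hk (mem_univ t))

/-- The point of the discontinuity argument: a `C^∞`-neighbourhood of `0` involves only finitely
many orders. The sets of this form generate a filter, which is compared with each topology making up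
the infimum. -/
theorem exists_setOf_iterDeriv_subset [T2Space E] {s : Set (SmoothCurve 𝕜 E)} (hs : s ∈ 𝓝 0) :
    ∃ K : ℕ, ∃ W ∈ 𝓝 (0 : E),
      {γ : SmoothCurve 𝕜 E | ∀ k ≤ K, ∀ t, SmoothCurve.iterDeriv k γ t ∈ W} ⊆ s := by
  let B : Filter (SmoothCurve 𝕜 E) :=
    { sets := {s | ∃ K : ℕ, ∃ W ∈ 𝓝 (0 : E),
        {γ : SmoothCurve 𝕜 E | ∀ k ≤ K, ∀ t, SmoothCurve.iterDeriv k γ t ∈ W} ⊆ s}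
      univ_sets := ⟨0, univ, univ_mem, subset_univ _⟩
      sets_of_superset := fun ⟨K, W, hW, h⟩ hst => ⟨K, W, hW, h.trans hst⟩
      inter_sets := fun ⟨K, W, hW, h⟩ ⟨K', W', hW', h'⟩ =>
        ⟨max K K', W ∩ W', inter_mem hW hW', fun γ hγ =>
          ⟨h fun k hk t => (hγ k (hk.trans (le_max_left _ _)) t).1,
            h' fun k hk t => (hγ k (hk.trans (le_max_right _ _)) t).2⟩⟩ }
  have hB : B ≤ 𝓝 0 := by
    rw [nhds_iInf]
    refine le_iInf fun k => ?_
    rw [nhds_iInf]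
    refine le_iInf fun _ => ?_
    rw [nhds_induced, ← tendsto_iff_comap, ContinuousMap.tendsto_nhds_compactOpen]
    intro C _ U hU hCU
    -- Only a point of `C` shows that `0 ∈ U`; for empty `C` the condition is void.
    rcases C.eq_empty_or_nonempty with rfl | ⟨t, ht⟩
    · exact Eventually.of_forall fun _ => mapsTo_empty _ _
    · have h0 := hCU ht
      rw [SmoothCurve.iterDeriv_zero_curve] at h0
      exact ⟨k, U, hU.mem_nhds h0, fun γ hγ r _ => hγ k le_rfl r⟩
  exact hB hs

theorem not_continuous_evol {E : ℕ+ → Type*} [∀ n, AddCommGroup (E n)] [∀ n, Module 𝕜 (E n)]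
    [∀ n, TopologicalSpace (E n)] [∀ n, IsTopologicalAddGroup (E n)] [∀ n, ContinuousSMul 𝕜 (E n)]
    {H : ℕ+ → Type*} [∀ n, Group (H n)] [∀ n, TopologicalSpace (H n)]
    [∀ n, ChartedSpace (E n) (H n)] (hLie : ∀ n, IsLieGroup 𝕜 (E n) (H n))
    (hex : ∀ n (γ : SmoothCurve 𝕜 (E n)), ∃ η : I → H n, IsProductIntegral 𝕜 γ η)
    (hDisc : ∀ n : ℕ+, ¬ Continuous[curveTopology 𝕜 (E n) ((n : ℕ) : ℕ∞), inferInstance]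
      (evol 𝕜 (E n) (H n))) :
    ¬ Continuous (evol 𝕜 (⨁ n, E n) (WeakDirectProduct H)) := by
  intro hcont
  have _ := fun n => (hLie n).model_t2
  -- Discontinuity is moved to `0` by the contrapositive of `continuous_evol_of_tendsto`.
  have hV : ∀ n, ∃ V : Set (H n), IsOpen V ∧ 1 ∈ V ∧
      evol 𝕜 (E n) (H n) ⁻¹' V ∉ @nhds _ (curveTopology 𝕜 (E n) ((n : ℕ) : ℕ∞)) 0 := fun n => by
    by_contra hcon
    push Not at hcon
    refine hDisc n (continuous_evol_of_tendsto (hLie n) (hex n) fun s hs => ?_)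
    obtain ⟨V, hVs, hVo, h1⟩ := mem_nhds_iff.1 hs
    exact mem_of_superset (hcon V hVo h1) (preimage_mono hVs)
  choose V hVo hV1 hVn using hV
  have hbox : {x : WeakDirectProduct H | ∀ n, x n ∈ V n} ∈
      𝓝 (evol 𝕜 (⨁ n, E n) (WeakDirectProduct H) 0) := by
    rw [evol_zero (WeakDirectProduct.isLieGroup hLie)]
    exact (WeakDirectProduct.mem_nhds _ _).2 ⟨V, hVo, hV1, subset_rfl⟩
  obtain ⟨K, W, hW, hKW⟩ := exists_setOf_iterDeriv_subset (hcont.tendsto 0 hbox)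
  -- Any index `n ≥ K` would do; `K + 1` is also positive when `K = 0`.
  let n : ℕ+ := K.succPNat
  have hKn : K ≤ n := Nat.le_succ K
  have hW' : directSumIncl 𝕜 E n ⁻¹' W ∈ 𝓝 0 :=
    (directSumIncl 𝕜 E n).continuous.tendsto 0 (by rwa [map_zero])
  refine hVn n (mem_of_superset (setOf_iterDeriv_mem_nhds n hW') fun γ hγ => ?_)
  have hmem : γ.map (directSumIncl 𝕜 E n) ∈ evol 𝕜 (⨁ n, E n) (WeakDirectProduct H) ⁻¹'
      {x : WeakDirectProduct H | ∀ n, x n ∈ V n} := hKW fun k hk t => by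
    rw [SmoothCurve.iterDeriv_map]
    exact hγ k (hk.trans hKn) t
  have h2 := hmem n
  rwa [evol_directSumIncl hLie hex] at h2

end Discontinuity

end LCLie

end

theorem proposition7p6 {𝕜 : Type*} [RCLike 𝕜]
    {E : ℕ+ → Type*} [∀ n, AddCommGroup (E n)] [∀ n, Module 𝕜 (E n)] [∀ n, TopologicalSpace (E n)]
    [∀ n, IsTopologicalAddGroup (E n)] [∀ n, ContinuousSMul 𝕜 (E n)]
    {H : ℕ+ → Type*} [∀ n, Group (H n)] [∀ n, TopologicalSpace (H n)]
    [∀ n, ChartedSpace (E n) (H n)]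
    (hLie : ∀ n, LCLie.IsLieGroup 𝕜 (E n) (H n))
    (hMackey : ∀ n, LCLie.IsMackeyComplete 𝕜 (E n))
    (hReg : ∀ n, LCLie.IsRegular 𝕜 (E n) (H n))
    (hDisc : ∀ n : ℕ+, ¬ Continuous[LCLie.curveTopology 𝕜 (E n) ((n : ℕ) : ℕ∞), inferInstance]
      (LCLie.evol 𝕜 (E n) (H n))) :
    LCLie.IsLieGroup 𝕜 (⨁ n, E n) (LCLie.WeakDirectProduct H) ∧
    (∀ n, LCLie.IsTangentMap 𝕜 (E n) (LCLie.WeakDirectProduct.inclusion H n)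
      (DirectSum.lof 𝕜 ℕ+ E n)) ∧
    LCLie.IsMackeyComplete 𝕜 (⨁ n, E n) ∧
    (∀ γ : LCLie.SmoothCurve 𝕜 (⨁ n, E n),
      ∃! η : unitInterval → LCLie.WeakDirectProduct H, LCLie.IsProductIntegral 𝕜 γ η) ∧
    ¬ Continuous (LCLie.evol 𝕜 (⨁ n, E n) (LCLie.WeakDirectProduct H)) ∧
    ¬ LCLie.IsRegular 𝕜 (⨁ n, E n) (LCLie.WeakDirectProduct H) := by
  have _ := fun n => (hLie n).model_t2
  have hG := LCLie.WeakDirectProduct.isLieGroup hLie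
  have hex := fun n => (hReg n).1
  have hnc := LCLie.not_continuous_evol hLie hex hDisc
  refine ⟨hG, LCLie.WeakDirectProduct.isTangentMap_inclusion,
    LCLie.isMackeyComplete_directSum hMackey, fun γ => ?_, hnc, fun h => hnc h.2.1⟩
  obtain ⟨η, hη, -⟩ := LCLie.exists_isProductIntegral hLie hex γ
  exact ⟨η, hη, fun ξ hξ => hξ.unique hG hη⟩
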